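/- Setting. Let $\mathcal G=(\mathcal V,\mathcal E)$ be a connected undirected graph on $n$ nodes and let $W=[w_{ij}]\in\mathbb R^{n\times n}$ be a mixing matrix: $w_{ij}=0$ if $i\ne j$ and $(i,j)\notin\mathcal E$, and $w_{ij}>0$ otherwise; $W=W^T$; $\mathrm{null}(I-W)=\mathrm{span}\{\mathbf 1\}$; and $I\succeq W\succ -I$. Let $\lambda_n(W)$ be the smallest eigenvalue of $W$. For $i=1,\dots,n$ let $f_i:\mathbb R^p\to\mathbb R$ be differentiable with $\|\nabla f_i(u)-\nabla f_i(v)\|\le L_{f_i}\|u-v\|$ for all $u,v$, where $L_{f_i}>0$, and put $L_f=\max_i L_{f_i}$. Let $r_i:\mathbb R^p\to\mathbb R\cup\{+\infty\}$ be such that each $f_i+r_i$ is proper, lower semicontinuous and coercive. For $\mathbf x\in\mathbb R^{n\times p}$ with rows $\mathbf x_{(i)}$, with the Frobenius norm and inner product, let $\nabla\mathbf f(\mathbf x)\in\mathbb R^{n\times p}$ have rows $\nabla f_i(\mathbf x_{(i)})^T$, let $r(\mathbf x)=\sum_i r_i(\mathbf x_{(i)})$, and $$\mathcal L_\alpha(\mathbf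 x)=\sum_{i=1}^n f_i(\mathbf x_{(i)})+\frac1{2\alpha}\langle \mathbf x,(I-W)\mathbf x\rangle,\qquad \hat{\mathcal L}_\alpha=\mathcal L_\alpha+r .$$ Let $\partial$ denote the limiting subdifferential; $\mathbf x$ is a stationary point of $h$ if $0\in\partial h(\mathbf x)$. A function $h$ has the Kurdyka–Łojasiewicz (KŁ) property at $\mathbf x^*\in\mathrm{dom}(\partial h)$ if there are $\eta\in(0,+\infty]$, a neighborhood $U$ of $\mathbf x^*$ and a continuous concave $\varphi:[0,\eta)\to\mathbb R_+$ with $\varphi(0)=0$, differentiable on $(0,\eta)$ with $\varphi'>0$ there, such that $\varphi'(h(\mathbf x)-h(\mathbf x^*))\,\mathrm{dist}(0,\partial h(\mathbf x))\ge1$ for all $\mathbf x\in U$ with $h(\mathbf x^*)<h(\mathbf x)<h(\mathbf x^*)+\eta$. Let $\alpha>0$ satisfy either (i) all $r_i$ are convex and $\alpha<(1+\lambda_n(W))/L_f$, or (ii) $\lambda_n(W)>0$ and $\alpha<\lambda_n(W)/L_f$ (the $r_i$ need not be convex). Let $\{\mathbf x^k\}_{k\ge0}\subset\mathbb R^{n\times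 p}$ be generated by Prox-DGD from an arbitrary $\mathbf x^0$: $$\mathbf x^{k+1}\in\operatorname*{argmin}_{\mathbf u}\Big\{\alpha r(\mathbf u)+\tfrac12\|\mathbf u-(W\mathbf x^k-\alpha\nabla\mathbf f(\mathbf x^k))\|^2\Big\}.$$ Let $\xi^{k+1}$ be determined by the proximal step, $\mathbf x^{k+1}+\alpha\xi^{k+1}=W\mathbf x^k-\alpha\nabla\mathbf f(\mathbf x^k)$, $k\ge 0$, and let $\xi^0\in\mathbb R^{n\times p}$ be arbitrary. Theorem (Global convergence of Prox-DGD). (a) $\{\mathbf x^k\}$ is bounded and has at least one accumulation point, and every accumulation point is a stationary point of $\hat{\mathcal L}_\alpha$. (b) For all $k\ge0$, $\xi^{k+1}\in\partial r(\mathbf x^{k+1})$, and there exists $\mathbf g^{k+1}\in\partial\hat{\mathcal L}_\alpha(\mathbf x^{k+1})$ with $$\|\mathbf g^{k+1}\|\le(\alpha^{-1}(2-\lambda_n(W))+L_f)\|\mathbf x^{k+1}-\mathbf x^k\|,$$ for instance $\mathbf g^{k+1}=\nabla\mathcal L_\alpha(\mathbf x^{k+1})+\xi^{k+1}$. (c)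 For every such choice of $\{\mathbf g^{k+1}\}$, the sequences $\{\|\mathbf x^{k+1}-\mathbf x^k\|^2\}$, $\{\|\mathbf g^{k+1}\|^2\}$ and $\{\|\frac1n\mathbf 1^T\nabla\mathbf f(\mathbf x^k)+\frac1n\mathbf 1^T\xi^k\|^2\}$ have running best rates $o(1/k)$, i.e. $\min_{i\le k}a_i=o(1/k)$ for each of these sequences $\{a_k\}_{k\ge 0}$. (d) $\frac1K\sum_{k=0}^{K-1}\|\frac1n\mathbf 1^T(\nabla\mathbf f(\mathbf x^k)+\xi^k)\|^2=O(1/K)$. (e) If $\hat{\mathcal L}_\alpha$ has the KŁ property at an accumulation point $\mathbf x^*$ of $\{\mathbf x^k\}$, then $\mathbf x^k\to\mathbf x^*$. -/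

import Mathlib

open Set Filter Topology

noncomputable section

namespace ProxDGD

/-! ### Nonsmooth analysis on a real Hilbert space -/

section Nonsmooth

variable {E : Type*} [NormedAddCommGroup E] [InnerProductSpace ℝ E]

/-- `h : E → ℝ ∪ {+∞}` is proper: it never takes the value `-∞` and is not identically `+∞`. -/
def Proper (h : E → EReal) : Prop := (∀ x, h x ≠ ⊥) ∧ ∃ x, h x ≠ ⊤

/-- `h u → +∞` as `‖u‖ → ∞`. -/
def Coercive (h : E → EReal) : Prop := Tendsto h (Bornology.cobounded E) (𝓝 ⊤)

/-- Convexity of an extended-real-valued function, through its epigraph. -/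
def ExtConvex (h : E → EReal) : Prop := Convex ℝ {q : E × ℝ | h q.1 ≤ (q.2 : EReal)}

/-- The regular (Fréchet) subdifferential: `v` such that `h` is finite at `x` and
`h y ≥ h x + ⟪v, y - x⟫ - o(‖y - x‖)` as `y → x`. -/
def regularSubdiff (h : E → EReal) (x : E) : Set E :=
  {v | h x ≠ ⊤ ∧ h x ≠ ⊥ ∧ ∀ ε : ℝ, 0 < ε → ∀ᶠ y in 𝓝 x,
    h x + ((inner ℝ v (y - x) - ε * ‖y - x‖ : ℝ) : EReal) ≤ h y}

/-- The limiting (Mordukhovich) subdifferential `∂h(x)`; it is empty where `h` is not finite. -/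
def limitingSubdiff (h : E → EReal) (x : E) : Set E :=
  {v | h x ≠ ⊤ ∧ h x ≠ ⊥ ∧ ∃ (y w : ℕ → E),
    Tendsto y atTop (𝓝 x) ∧ Tendsto (fun k => h (y k)) atTop (𝓝 (h x)) ∧
    (∀ k, w k ∈ regularSubdiff h (y k)) ∧ Tendsto w atTop (𝓝 v)}

/-- `x` is a stationary point of `h`. -/
def IsStationary (h : E → EReal) (x : E) : Prop := (0 : E) ∈ limitingSubdiff h x

/-- The Kurdyka–Łojasiewicz property of `h` at `xs`. The distance to the empty set is `+∞`. -/
def HasKL (h : E → EReal) (xs : E) : Prop :=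
  (limitingSubdiff h xs).Nonempty ∧
  ∃ (η : EReal) (U : Set E) (φ : ℝ → ℝ), 0 < η ∧ U ∈ 𝓝 xs ∧
    ContinuousOn φ {s : ℝ | 0 ≤ s ∧ (s : EReal) < η} ∧
    ConcaveOn ℝ {s : ℝ | 0 ≤ s ∧ (s : EReal) < η} φ ∧
    (∀ s : ℝ, 0 ≤ s → (s : EReal) < η → 0 ≤ φ s) ∧
    φ 0 = 0 ∧
    (∀ s : ℝ, 0 < s → (s : EReal) < η → DifferentiableAt ℝ φ s) ∧
    (∀ s : ℝ, 0 < s → (s : EReal) < η → 0 < deriv φ s) ∧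
    ∀ x ∈ U, h xs < h x → h x < h xs + η →
      1 ≤ ENNReal.ofReal (deriv φ (h x - h xs).toReal) *
        Metric.infEDist 0 (limitingSubdiff h x)

/-- The (possibly set-valued) proximal map
`prox_{t h}(z) = argmin_u { t h(u) + ‖u - z‖² / 2 }`. -/
def proxSet (t : ℝ) (h : E → EReal) (z : E) : Set E :=
  {u | ∀ v : E, (t : EReal) * h u + ((‖u - z‖ ^ 2 / 2 : ℝ) : EReal) ≤
    (t : EReal) * h v + ((‖v - z‖ ^ 2 / 2 : ℝ) : EReal)}

end Nonsmooth

/-! ### Running best rates -/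

/-- `b_k = min {a_i : i ≤ k}`. -/
def runningBest (a : ℕ → ℝ) (k : ℕ) : ℝ :=
  (Finset.range (k + 1)).inf' Finset.nonempty_range_add_one a

/-- The sequence `a` has a running best rate of `o(1/k)`. -/
def RunningBestLittleO (a : ℕ → ℝ) : Prop :=
  Asymptotics.IsLittleO atTop (runningBest a) (fun k : ℕ => 1 / (k : ℝ))

/-! ### The decentralized problem -/

section Network

variable {n p : ℕ}

/-- The space `ℝ^p` with its Euclidean norm. -/
abbrev Vec (p : ℕ) : Type := EuclideanSpace ℝ (Fin p)

/-- The space `ℝ^{n × p}` with the Frobenius norm; `x i` is the `i`-th row. -/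
abbrev Mat (n p : ℕ) : Type := PiLp 2 (fun _ : Fin n => Vec p)

/-- The product `A x` of an `n × n` matrix `A` and an `n × p` matrix `x`. -/
def mulMat (A : Matrix (Fin n) (Fin n) ℝ) (x : Mat n p) : Mat n p :=
  WithLp.toLp 2 (fun i => ∑ j, A i j • x j)

/-- The row vector `(1/n) 1ᵀ x`. -/
def rowAvg (x : Mat n p) : Vec p := (n : ℝ)⁻¹ • ∑ i, x i

/-- `W` is a mixing matrix for the network `G`. -/
structure IsMixing (G : SimpleGraph (Fin n)) (W : Matrix (Fin n) (Fin n) ℝ) : Prop where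
  zero_of_not_adj : ∀ i j, i ≠ j → ¬ G.Adj i j → W i j = 0
  pos_of_eq_or_adj : ∀ i j, i = j ∨ G.Adj i j → 0 < W i j
  symm : W.IsHermitian
  null_space : LinearMap.ker (Matrix.toLin' (1 - W)) = Submodule.span ℝ {fun _ => (1 : ℝ)}
  le_one : (1 - W).PosSemidef
  neg_one_lt : (W + 1).PosDef

/-- The smallest eigenvalue `λ_n(W)` of a symmetric matrix. -/
def lambdaMin {W : Matrix (Fin n) (Fin n) ℝ} (hW : W.IsHermitian) : ℝ := ⨅ i, hW.eigenvalues i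

/-- The stacked gradient `∇f(x)`, whose rows are `∇f_i(x_i)`. -/
def gradF (f : Fin n → Vec p → ℝ) (x : Mat n p) : Mat n p :=
  WithLp.toLp 2 (fun i => gradient (f i) (x i))

/-- `r(x) = ∑ i, r_i(x_i)`. -/
def rSum (r : Fin n → Vec p → EReal) (x : Mat n p) : EReal := ∑ i, r i (x i)

/-- `f_i` is Lipschitz differentiable with constant `Lf i > 0`, and each `f_i + r_i` is proper,
lower semicontinuous and coercive. -/
structure IsCompositeObjective (f : Fin n → Vec p → ℝ) (r : Fin n → Vec p → EReal)
    (Lf : Fin n → ℝ) : Prop where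
  lip_pos : ∀ i, 0 < Lf i
  differentiable : ∀ i, Differentiable ℝ (f i)
  lipschitz : ∀ i u v, ‖gradient (f i) u - gradient (f i) v‖ ≤ Lf i * ‖u - v‖
  proper : ∀ i, Proper (fun u => (f i u : EReal) + r i u)
  lsc : ∀ i, LowerSemicontinuous (fun u => (f i u : EReal) + r i u)
  coercive : ∀ i, Coercive (fun u => (f i u : EReal) + r i u)

/-- `L_α(x) = ∑ i, f_i(x_i) + (1 / (2α)) ⟪x, (I - W) x⟫`. -/
def lyap (f : Fin n → Vec p → ℝ) (W : Matrix (Fin n) (Fin n) ℝ) (α : ℝ) (x : Mat n p) : ℝ :=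
  ∑ i, f i (x i) + 1 / (2 * α) * inner ℝ x (mulMat (1 - W) x)

/-- The Lyapunov function `L_α + r` of the composite problem. -/
def lyapHat (f : Fin n → Vec p → ℝ) (r : Fin n → Vec p → EReal)
    (W : Matrix (Fin n) (Fin n) ℝ) (α : ℝ) (x : Mat n p) : EReal :=
  (lyap f W α x : EReal) + rSum r x

/-- `x` is a sequence generated by Prox-DGD with fixed step size `α`
(from an arbitrary starting point; any minimizer may be selected in the proximal step). -/
def IsProxDGD (f : Fin n → Vec p → ℝ) (r : Fin n → Vec p → EReal)
    (W : Matrix (Fin n) (Fin n) ℝ) (α : ℝ) (x : ℕ → Mat n p) : Prop :=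
  ∀ k, x (k + 1) ∈ proxSet α (rSum r) (mulMat W (x k) - α • gradF f (x k))

end Network

end ProxDGD

end

/-! Since (I − W)x = x − Wx, the forward point Wx − α∇f(x) equals x − α∇L_α(x). Prox-DGD is
therefore the proximal gradient method with step α for L_α + r, and three facts carry the analysis.

Descent (`exists_descent`): L_α lies below its quadratic model of curvature L + α⁻¹(1 − λ_n), and
the proximal step gains κ‖y − x‖²/(2α), with κ = 1 from minimality alone and κ = 2 for convex r.
Each step-size condition says that κ − 1 + λ_n − αL > 0.

Relative error (`norm_gradient_lyap_add_le`): the subgradient ∇L_α(x^{k+1}) + ξ^{k+1} is at most a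
constant times the last step, because ‖W‖ ≤ 1.

Continuity (`eq_of_tendsto_proxSet`): values converge to the value at the cluster point. Lower
semicontinuity gives one inequality, minimality of the proximal point the other.

Descent and a lower bound make the squared steps summable, and summability of a nonnegative sequence
yields both the o(1/k) running best and the O(1/K) average. Subgradients inherit this by relative
error, and averaged residuals do so because 1ᵀ(I − W) = 0. Coercivity keeps the iterates bounded;
subgradients tending to 0 along convergent values make cluster points stationary. Under KŁ the
trajectory has finite length (`tendsto_of_hasKL`). -/

namespace ProxDGD

/-! ### Subgradients, proximal points and the descent lemma -/

section Subdifferential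

variable {E : Type*} [NormedAddCommGroup E] [InnerProductSpace ℝ E]

theorem regularSubdiff_subset_limitingSubdiff (h : E → EReal) (x : E) :
    regularSubdiff h x ⊆ limitingSubdiff h x := fun v hv =>
  ⟨hv.1, hv.2.1, fun _ => x, fun _ => v, tendsto_const_nhds, tendsto_const_nhds,
    fun _ => hv, tendsto_const_nhds⟩

theorem add_mem_regularSubdiff_of_hasGradientAt [CompleteSpace E] {g : E → ℝ} {h : E → EReal}
    {G v x : E} (hg : HasGradientAt g G x) (hv : v ∈ regularSubdiff h x) :
    G + v ∈ regularSubdiff (fun y => (g y : EReal) + h y) x := by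
  obtain ⟨htop, hbot, hv⟩ := hv
  lift h x to ℝ using ⟨htop, hbot⟩ with s hs
  refine ⟨?_, ?_, fun ε hε => ?_⟩
  · simp only [← hs, ← EReal.coe_add]; exact EReal.coe_ne_top _
  · simp only [← hs, ← EReal.coe_add]; exact EReal.coe_ne_bot _
  have h1 := (hasGradientAt_iff_isLittleO.1 hg).def (half_pos hε)
  filter_upwards [h1, hv (ε / 2) (half_pos hε)] with y hy1 hy2
  simp only [← hs]
  rw [← EReal.coe_add] at hy2
  induction hhy : h y with
  | bot => rw [hhy] at hy2; exact absurd (le_bot_iff.1 hy2) (EReal.coe_ne_bot _)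
  | top => simp
  | coe t =>
    rw [hhy] at hy2
    norm_cast at hy2 ⊢
    rw [Real.norm_eq_abs, abs_le] at hy1
    rw [inner_add_left]
    linarith [hy1.1]

theorem ne_top_of_mem_proxSet {E : Type*} [NormedAddCommGroup E] {α : ℝ} (hα : 0 < α) {r : E → EReal} {z u v : E}
    (hu : u ∈ proxSet α r z) (hv : r v ≠ ⊤) (hv' : r v ≠ ⊥) : r u ≠ ⊤ := by
  intro h
  have := hu v
  lift r v to ℝ using ⟨hv, hv'⟩ with s hs
  rw [h, EReal.coe_mul_top_of_pos hα, EReal.top_add_coe, top_le_iff, ← EReal.coe_mul,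
    ← EReal.coe_add] at this
  exact EReal.coe_ne_top _ this

theorem toReal_le_of_mem_proxSet {E : Type*} [NormedAddCommGroup E] {α : ℝ} {r : E → EReal} {z u v : E}
    (hu : u ∈ proxSet α r z) (hu1 : r u ≠ ⊤) (hu2 : r u ≠ ⊥) (hv1 : r v ≠ ⊤) (hv2 : r v ≠ ⊥) :
    α * (r u).toReal + ‖u - z‖ ^ 2 / 2 ≤ α * (r v).toReal + ‖v - z‖ ^ 2 / 2 := by
  have := hu v
  lift r v to ℝ using ⟨hv1, hv2⟩ with s hs
  lift r u to ℝ using ⟨hu1, hu2⟩ with t ht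
  simp only [EReal.toReal_coe]
  exact_mod_cast this

theorem norm_sub_sq_expand (u v z : E) :
    ‖v - z‖ ^ 2 = ‖u - z‖ ^ 2 - 2 * inner ℝ (z - u) (v - u) + ‖v - u‖ ^ 2 := by
  have : v - z = (v - u) - (z - u) := by abel
  rw [this, norm_sub_sq_real, norm_sub_rev u z, real_inner_comm]
  ring

/-- Minimality of `u` gives a global lower bound on `r` that is affine up to ‖y − u‖²/(2α), and this
error is o(‖y − u‖). No convexity is involved. -/
theorem smul_sub_mem_regularSubdiff_of_mem_proxSet {α : ℝ} (hα : 0 < α) {r : E → EReal}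
    (hbot : ∀ x, r x ≠ ⊥) {z u : E} (hu : u ∈ proxSet α r z) (hu1 : r u ≠ ⊤) :
    α⁻¹ • (z - u) ∈ regularSubdiff r u := by
  refine ⟨hu1, hbot u, fun ε hε => ?_⟩
  -- Within this radius the error ‖y − u‖²/(2α) is at most ε‖y − u‖.
  have hev : ∀ᶠ y in 𝓝 u, ‖y - u‖ < 2 * α * ε := by
    have : Tendsto (fun y => ‖y - u‖) (𝓝 u) (𝓝 0) := by
      have : Continuous (fun y => ‖y - u‖) := by fun_prop
      simpa using this.tendsto u
    exact this.eventually_lt_const (by positivity)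
  filter_upwards [hev] with y hy
  by_cases hy1 : r y = ⊤
  · rw [hy1]; exact le_top
  have key := toReal_le_of_mem_proxSet hu hu1 (hbot u) hy1 (hbot y)
  rw [norm_sub_sq_expand u y z] at key
  have hb := hbot y
  have hb' := hbot u
  lift r y to ℝ using ⟨hy1, hb⟩ with s hs
  lift r u to ℝ using ⟨hu1, hb'⟩ with t ht
  simp only [EReal.toReal_coe] at key
  norm_cast
  rw [real_inner_smul_left]
  have h1 : ‖y - u‖ ^ 2 ≤ 2 * α * ε * ‖y - u‖ := by nlinarith [norm_nonneg (y - u)]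
  have h2 : α * (t + (α⁻¹ * inner ℝ (z - u) (y - u) - ε * ‖y - u‖)) ≤ α * s := by
    have : α * (t + (α⁻¹ * inner ℝ (z - u) (y - u) - ε * ‖y - u‖)) =
      α * t + inner ℝ (z - u) (y - u) - α * ε * ‖y - u‖ := by field_simp; ring
    rw [this]; nlinarith
  exact le_of_mul_le_mul_left h2 hα

/-- The variational inequality of a proximal step, for a function that is convex along the segment
from the proximal point to `v`. -/
theorem inner_le_of_mem_proxSet_of_convex {α : ℝ} {r : E → EReal}
    {z u v : E} (hu : u ∈ proxSet α r z)
    (hu1 : r u ≠ ⊤) (hu2 : r u ≠ ⊥)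
    (hconv : ∀ t : ℝ, 0 < t → t < 1 → r (u + t • (v - u)) ≠ ⊤ ∧ r (u + t • (v - u)) ≠ ⊥ ∧
      (r (u + t • (v - u))).toReal ≤ (1 - t) * (r u).toReal + t * (r v).toReal) (hα : 0 < α) :
    inner ℝ (z - u) (v - u) ≤ α * ((r v).toReal - (r u).toReal) := by
  -- Comparing `u` with the point at parameter t and dividing by t leaves a factor t on the
  -- quadratic term, which vanishes as t → 0⁺.
  have key : ∀ t : ℝ, 0 < t → t < 1 → inner ℝ (z - u) (v - u) - t * (‖v - u‖ ^ 2 / 2) ≤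
      α * ((r v).toReal - (r u).toReal) := by
    intro t ht ht1
    obtain ⟨h1, h2, h3⟩ := hconv t ht ht1
    have h4 := toReal_le_of_mem_proxSet hu hu1 hu2 h1 h2
    rw [norm_sub_sq_expand u (u + t • (v - u)) z, add_sub_cancel_left, inner_smul_right,
      norm_smul, mul_pow, Real.norm_eq_abs, sq_abs] at h4
    have h5 := mul_le_mul_of_nonneg_left h3 hα.le
    refine le_of_mul_le_mul_left ?_ ht
    nlinarith
  have hlim : Tendsto (fun t : ℝ => inner ℝ (z - u) (v - u) - t * (‖v - u‖ ^ 2 / 2)) (𝓝[>] 0)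
      (𝓝 (inner ℝ (z - u) (v - u))) := by
    have : Continuous (fun t : ℝ => inner ℝ (z - u) (v - u) - t * (‖v - u‖ ^ 2 / 2)) := by
      fun_prop
    have := (this.tendsto 0).mono_left (nhdsWithin_le_nhds (s := Ioi 0))
    simpa using this
  refine le_of_tendsto hlim ?_
  filter_upwards [Ioo_mem_nhdsGT (zero_lt_one (α := ℝ))] with t ht
  exact key t ht.1 ht.2

/-- The descent lemma for a function with a Lipschitz gradient. -/
theorem le_add_inner_add_of_lipschitz_gradient [CompleteSpace E] {f : E → ℝ} {L : ℝ}
    (hf : Differentiable ℝ f)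
    (hL : ∀ u v, ‖gradient f u - gradient f v‖ ≤ L * ‖u - v‖) (x y : E) :
    f y ≤ f x + inner ℝ (gradient f x) (y - x) + L / 2 * ‖y - x‖ ^ 2 := by
  set d := y - x with hd
  -- The claim is ψ(1) ≤ ψ(0); the Lipschitz bound makes ψ' ≤ 0 on (0, 1).
  let ψ : ℝ → ℝ := fun t => f (x + t • d) - t * inner ℝ (gradient f x) d - L / 2 * t ^ 2 * ‖d‖ ^ 2
  have hder : ∀ t, HasDerivAt ψ
      (inner ℝ (gradient f (x + t • d)) d - inner ℝ (gradient f x) d - L * t * ‖d‖ ^ 2) t := by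
    intro t
    have h1 : HasDerivAt (fun t : ℝ => x + t • d) d t := by
      simpa using ((hasDerivAt_id t).smul_const d).const_add x
    have h2 := (hf (x + t • d)).hasGradientAt.hasFDerivAt.comp_hasDerivAt t h1
    have h3 : HasDerivAt (fun t : ℝ => t * inner ℝ (gradient f x) d)
      (inner ℝ (gradient f x) d) t := by
      simpa using (hasDerivAt_id t).mul_const (inner ℝ (gradient f x) d)
    have h4 : HasDerivAt (fun t : ℝ => L / 2 * t ^ 2 * ‖d‖ ^ 2) (L * t * ‖d‖ ^ 2) t := by
      have := (((hasDerivAt_id t).pow 2).const_mul (L / 2)).mul_const (‖d‖ ^ 2)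
      refine this.congr_deriv ?_
      simp only [id_eq]; ring
    exact (h2.sub h3).sub h4
  have hanti : AntitoneOn ψ (Icc 0 1) := by
    refine antitoneOn_of_deriv_nonpos (convex_Icc 0 1)
      (fun t _ => (hder t).continuousAt.continuousWithinAt)
      (fun t _ => (hder t).differentiableAt.differentiableWithinAt) fun t ht => ?_
    rw [interior_Icc] at ht
    rw [(hder t).deriv, ← inner_sub_left]
    have h1 := real_inner_le_norm (gradient f (x + t • d) - gradient f x) d
    have h2 := hL (x + t • d) x
    rw [add_sub_cancel_left, norm_smul, Real.norm_eq_abs, abs_of_pos ht.1] at h2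
    nlinarith [mul_le_mul_of_nonneg_right h2 (norm_nonneg d)]
  have := hanti (left_mem_Icc.2 zero_le_one) (right_mem_Icc.2 zero_le_one) zero_le_one
  simp only [ψ, zero_smul, one_smul, add_zero] at this
  rw [hd, add_sub_cancel, ← hd] at this
  linarith

end Subdifferential

/-! ### Running best rates from summability -/

section RunningBest

theorem runningBest_nonneg {a : ℕ → ℝ} (ha : ∀ k, 0 ≤ a k) (k : ℕ) : 0 ≤ runningBest a k :=
  Finset.le_inf' _ _ fun i _ => ha i

theorem runningBest_le (a : ℕ → ℝ) {i k : ℕ} (h : i ≤ k) : runningBest a k ≤ a i :=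
  Finset.inf'_le _ (Finset.mem_range.2 (Nat.lt_succ_of_le h))

/-- The running minimum at k is below every term with index from k/2 to k − 1, so k/2 times it is at
most a tail of the series, which tends to 0. -/
theorem runningBestLittleO_of_summable {a : ℕ → ℝ} (ha : ∀ k, 0 ≤ a k) (hs : Summable a) :
    RunningBestLittleO a := by
  have hdiv : Tendsto (fun k : ℕ => k / 2) atTop atTop :=
    Nat.tendsto_div_const_atTop (by norm_num)
  have hT := (tendsto_sum_nat_add a).comp hdiv
  have hbound : ∀ k : ℕ, (k : ℝ) / 2 * runningBest a k ≤ ∑' i, a (i + k / 2) := by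
    intro k
    have hsum := (summable_nat_add_iff (k / 2)).2 hs
    have h1 := hsum.sum_le_tsum (Finset.range (k - k / 2)) (fun i _ => ha _)
    have h2 : ∑ _i ∈ Finset.range (k - k / 2), runningBest a k ≤
        ∑ i ∈ Finset.range (k - k / 2), a (i + k / 2) := by
      refine Finset.sum_le_sum fun i hi => runningBest_le a ?_
      have := Finset.mem_range.1 hi
      omega
    rw [Finset.sum_const, Finset.card_range, nsmul_eq_mul] at h2
    have h3 : (k : ℝ) / 2 ≤ ((k - k / 2 : ℕ) : ℝ) := by
      have : k ≤ 2 * (k - k / 2) := by omega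
      have : (k : ℝ) ≤ 2 * ((k - k / 2 : ℕ) : ℝ) := by exact_mod_cast this
      linarith
    exact (mul_le_mul_of_nonneg_right h3 (runningBest_nonneg ha k)).trans (h2.trans h1)
  refine Asymptotics.isLittleO_of_tendsto' ?_ ?_
  -- The comparison function 1/k is zero only at k = 0, where division by zero returns 0.
  · filter_upwards [eventually_gt_atTop 0] with k hk h0
    have : (k : ℝ) ≠ 0 := by positivity
    simp [this] at h0
  · refine squeeze_zero (g := fun k : ℕ => 2 * ∑' i, a (i + k / 2)) (fun k => ?_) (fun k => ?_) ?_
    · exact div_nonneg (runningBest_nonneg ha k) (by positivity)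
    · rw [div_div_eq_mul_div, div_one]
      linarith [hbound k]
    · simpa using hT.const_mul 2

end RunningBest

/-! ### Finite length under the Kurdyka–Łojasiewicz property -/

section KurdykaLojasiewicz

variable {E : Type*} [NormedAddCommGroup E] [InnerProductSpace ℝ E]

/-- The partial length of the trajectory is controlled as long as every step satisfies the
inequality obtained from the Kurdyka–Łojasiewicz property. -/
theorem sum_le_of_two_mul_le {d Φ : ℕ → ℝ} {N : ℕ}
    (h : ∀ k < N, 2 * d (k + 1) ≤ d k + (Φ k - Φ (k + 1))) :
    ∑ k ∈ Finset.range N, d (k + 1) + d N ≤ d 0 + (Φ 0 - Φ N) := by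
  induction N with
  | zero => simp
  | succ N ih =>
    have := ih fun k hk => h k (hk.trans (Nat.lt_succ_self N))
    have := h N (Nat.lt_succ_self N)
    rw [Finset.sum_range_succ]
    linarith

/-- KŁ converts the decrease of `H` into a decrease of φ(H − Hs), which telescopes and bounds the
path length while the iterates stay near `xs`. Started close enough to `xs`, the path is too short
to leave the neighbourhood, so the bound persists and the sequence is Cauchy. -/
theorem tendsto_of_hasKL [CompleteSpace E] {h : E → EReal} {x : ℕ → E} {H : ℕ → ℝ}
    (hH : ∀ k, h (x k) = H k) {a b : ℝ} (ha : 0 < a) (hb : 0 ≤ b)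
    (hdec : ∀ k, H (k + 1) + a * ‖x (k + 1) - x k‖ ^ 2 ≤ H k)
    (hsub : ∀ k, ∃ g ∈ limitingSubdiff h (x (k + 1)), ‖g‖ ≤ b * ‖x (k + 1) - x k‖)
    {xs : E} (hcl : MapClusterPt xs atTop x) {Hs : ℝ} (hHs : h xs = Hs)
    (hlim : Tendsto H atTop (𝓝 Hs)) (hKL : HasKL h xs) : Tendsto x atTop (𝓝 xs) := by
  have hanti : Antitone H := antitone_nat_of_succ_le fun k => by
    have := hdec k
    nlinarith [mul_nonneg ha.le (sq_nonneg ‖x (k + 1) - x k‖)]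
  have hge : ∀ k, Hs ≤ H k := fun k => hanti.le_of_tendsto hlim k
  suffices hsum : Summable fun k => ‖x (k + 1) - x k‖ by
    have hc : CauchySeq x := cauchySeq_of_summable_dist (by
      simpa [dist_eq_norm, norm_sub_rev] using hsum)
    obtain ⟨ψ, hψ, hlimψ⟩ := hcl.tendsto_subseq
    exact tendsto_nhds_of_cauchySeq_of_subseq hc hψ.tendsto_atTop hlimψ
  -- If the limit value is attained, descent forces all later steps to be zero. Otherwise `H` stays
  -- strictly above `Hs`, as KŁ requires.
  by_cases hex : ∃ K, H K = Hs
  · obtain ⟨K, hK⟩ := hex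
    refine (summable_nat_add_iff K).1 ?_
    have : (fun k => ‖x (k + K + 1) - x (k + K)‖) = fun _ => 0 := by
      funext k
      have h1 := hdec (k + K)
      have h2 := hanti (Nat.le_add_left K k)
      have h3 := hge (k + K + 1)
      have h4 : ‖x (k + K + 1) - x (k + K)‖ ^ 2 ≤ 0 := by
        by_contra hcon
        push Not at hcon
        nlinarith [mul_pos ha hcon]
      exact pow_eq_zero_iff (two_ne_zero) |>.1 (le_antisymm h4 (sq_nonneg _))
    rw [this]; exact summable_zero
  push Not at hex
  have hgt : ∀ k, Hs < H k := fun k => lt_of_le_of_ne (hge k) (Ne.symm (hex k))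
  obtain ⟨-, η, U, φ, hη, hU, hφc, hφconc, hφnn, hφ0, hφd, hφpos, hφ⟩ := hKL
  obtain ⟨ρ, hρ, hρU⟩ := Metric.mem_nhds_iff.1 hU
  -- A real threshold replaces `η`, which may be +∞.
  obtain ⟨η₀, hη₀, hη₀η⟩ := EReal.lt_iff_exists_real_btwn.1 hη
  have hη₀pos : 0 < η₀ := by exact_mod_cast hη₀
  have hmem : ∀ s : ℝ, s < η₀ → (s : EReal) < η := fun s hs =>
    (EReal.coe_lt_coe_iff.2 hs).trans hη₀η
  have hs0 : Tendsto (fun k => H k - Hs) atTop (𝓝 0) := by simpa using hlim.sub_const Hs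
  have hsη : ∀ᶠ k in atTop, H k - Hs < η₀ := hs0.eventually_lt_const hη₀pos
  have hφlim : Tendsto (fun k => b / a * φ (H k - Hs)) atTop (𝓝 0) := by
    have h1 : Tendsto φ (𝓝[{s : ℝ | 0 ≤ s ∧ (s : EReal) < η}] 0) (𝓝 0) := by
      have := hφc 0 ⟨le_rfl, by exact_mod_cast hη⟩
      rwa [ContinuousWithinAt, hφ0] at this
    have h2 : Tendsto (fun k => H k - Hs) atTop (𝓝[{s : ℝ | 0 ≤ s ∧ (s : EReal) < η}] 0) := by
      refine tendsto_nhdsWithin_iff.2 ⟨hs0, ?_⟩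
      filter_upwards [hsη] with k hk using ⟨sub_nonneg.2 (hge k), hmem _ hk⟩
    simpa using (h1.comp h2).const_mul (b / a)
  have hdlim : Tendsto (fun k => ‖x (k + 1) - x k‖) atTop (𝓝 0) := by
    have h1 : Tendsto (fun k => ‖x (k + 1) - x k‖ ^ 2) atTop (𝓝 0) := by
      refine squeeze_zero (g := fun k => a⁻¹ * (H k - Hs)) (fun k => sq_nonneg _) (fun k => ?_)
        (by simpa using hs0.const_mul a⁻¹)
      rw [← div_eq_inv_mul, le_div_iff₀ ha]
      linarith [hdec k, hge (k + 1)]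
    have := (Real.continuous_sqrt.tendsto 0).comp h1
    simpa [Function.comp_def] using this
  set d : ℕ → ℝ := fun k => ‖x (k + 1) - x k‖ with hd
  have hstep : ∀ k, x (k + 1) ∈ Metric.ball xs ρ → H (k + 1) - Hs < η₀ →
      2 * d (k + 1) ≤
        d k + (b / a * φ (H (k + 1) - Hs) - b / a * φ (H (k + 1 + 1) - Hs)) := by
    intro k hk hkη
    have hpos : 0 < H (k + 1) - Hs := sub_pos.2 (hgt (k + 1))
    obtain ⟨g, hg, hgb⟩ := hsub k
    have hKLk := hφ (x (k + 1)) (hρU hk)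
      (by rw [hHs, hH]; exact_mod_cast hgt (k + 1))
      (by
        rw [hHs, hH]
        refine lt_of_lt_of_le ?_ (add_le_add_right hη₀η.le _)
        exact_mod_cast (by linarith : H (k + 1) < Hs + η₀))
    have hval : (h (x (k + 1)) - h xs).toReal = H (k + 1) - Hs := by
      rw [hHs, hH, ← EReal.coe_sub, EReal.toReal_coe]
    rw [hval] at hKLk
    set m := deriv φ (H (k + 1) - Hs)
    have hm : 0 < m := hφpos _ hpos (hmem _ hkη)
    -- The subgradient at `x (k + 1)` bounds the distance in the KŁ inequality by the preceding
    -- step. In particular `d k` cannot vanish.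
    have hone : 1 ≤ m * (b * d k) := by
      have h1 : Metric.infEDist 0 (limitingSubdiff h (x (k + 1))) ≤ ENNReal.ofReal ‖g‖ := by
        refine (Metric.infEDist_le_edist_of_mem hg).trans ?_
        rw [edist_dist, dist_zero_left]
      have h2 := hKLk.trans (mul_le_mul_right (h1.trans (ENNReal.ofReal_le_ofReal hgb)) _)
      rw [← ENNReal.ofReal_mul hm.le] at h2
      exact ENNReal.one_le_ofReal.1 h2
    -- By concavity, the derivative at the right endpoint is at most the slope of the chord.
    have hconc : m * (H (k + 1) - H (k + 1 + 1)) ≤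
        φ (H (k + 1) - Hs) - φ (H (k + 1 + 1) - Hs) := by
      rcases (hanti (Nat.le_succ (k + 1))).eq_or_lt with heq | hlt
      · simp only [Nat.succ_eq_add_one] at heq
        rw [heq]; simp
      · have hlt' : H (k + 1 + 1) - Hs < H (k + 1) - Hs := sub_lt_sub_right hlt Hs
        have := hφconc.deriv_le_slope ⟨sub_nonneg.2 (hge (k + 1 + 1)), hmem _ (hlt'.trans hkη)⟩
          ⟨hpos.le, hmem _ hkη⟩ hlt' (hφd _ hpos (hmem _ hkη))
        rw [slope_def_field, le_div_iff₀ (sub_pos.2 hlt')] at this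
        linarith
    have hΔ : a * d (k + 1) ^ 2 ≤
        b * d k * (φ (H (k + 1) - Hs) - φ (H (k + 1 + 1) - Hs)) := by
      have h1 : a * d (k + 1) ^ 2 ≤ H (k + 1) - H (k + 1 + 1) := by linarith [hdec (k + 1)]
      have h2 : 0 ≤ a * d (k + 1) ^ 2 := by positivity
      have h3 : 0 < b * d k := by
        by_contra hcon
        nlinarith [mul_nonneg hm.le (neg_nonneg.2 (not_lt.1 hcon))]
      calc a * d (k + 1) ^ 2 ≤ (m * (b * d k)) * (a * d (k + 1) ^ 2) :=
            le_mul_of_one_le_left h2 hone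
        _ ≤ (m * (b * d k)) * (H (k + 1) - H (k + 1 + 1)) :=
            mul_le_mul_of_nonneg_left h1 (by positivity)
        _ = b * d k * (m * (H (k + 1) - H (k + 1 + 1))) := by ring
        _ ≤ _ := mul_le_mul_of_nonneg_left hconc h3.le
    set Δ := φ (H (k + 1) - Hs) - φ (H (k + 1 + 1) - Hs) with hΔdef
    have hsq : d (k + 1) ^ 2 ≤ d k * (b / a * Δ) := by
      have : d k * (b / a * Δ) = b * d k * Δ / a := by ring
      rw [this, le_div_iff₀ ha]; linarith
    have hdk : 0 ≤ d k := norm_nonneg _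
    have hΔ0 : 0 ≤ b / a * Δ := by
      by_contra hcon
      push Not at hcon
      rcases hdk.eq_or_lt with h0 | h0
      · rw [← h0] at hone; norm_num at hone
      · nlinarith [mul_neg_of_pos_of_neg h0 hcon, sq_nonneg (d (k + 1))]
    rw [← mul_sub, ← hΔdef]
    -- The arithmetic–geometric mean inequality, which makes the estimate linear and hence summable.
    have h4 : (2 * d (k + 1)) ^ 2 ≤ (d k + b / a * Δ) ^ 2 := by
      nlinarith [sq_nonneg (d k - b / a * Δ)]
    exact (le_abs_self _).trans (abs_le_of_sq_le_sq h4 (by positivity))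
  -- Four quarters of ρ are spent: the distance from `x K` to `xs`, the step `d K` once as the move
  -- to `x (K + 1)` and once in the length bound, and the initial φ term.
  obtain ⟨K, hKx, hKd, hKφ, hKη⟩ : ∃ K, x K ∈ Metric.ball xs (ρ / 4) ∧ d K < ρ / 4 ∧
      b / a * φ (H (K + 1) - Hs) < ρ / 4 ∧ ∀ k, K ≤ k → H k - Hs < η₀ := by
    have h1 := hcl.frequently (Metric.ball_mem_nhds xs (by positivity : 0 < ρ / 4))
    have h2 := hdlim.eventually_lt_const (by positivity : 0 < ρ / 4)
    have h3 := ((tendsto_add_atTop_iff_nat 1).2 hφlim).eventually_lt_const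
      (by positivity : 0 < ρ / 4)
    have h4 := eventually_forall_ge_atTop.2 hsη
    exact (h1.and_eventually (h2.and (h3.and h4))).exists
  set Φ : ℕ → ℝ := fun k => b / a * φ (H (K + k + 1) - Hs) with hΦ
  have hΦnn : ∀ k, 0 ≤ Φ k := fun k => mul_nonneg (by positivity)
    (hφnn _ (sub_nonneg.2 (hge _)) (hmem _ (hKη _ (by omega))))
  have hlen : ∀ N, (∀ k < N, x (K + k + 1) ∈ Metric.ball xs ρ) →
      ∑ k ∈ Finset.range N, d (K + (k + 1)) ≤ d K + Φ 0 := by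
    intro N hN
    have := sum_le_of_two_mul_le (d := fun k => d (K + k)) (Φ := Φ) (N := N)
      fun k hk => hstep (K + k) (hN k hk) (hKη _ (by omega))
    have h1 : 0 ≤ d (K + N) := norm_nonneg _
    have h2 := hΦnn N
    simp only [add_zero] at this
    linarith
  -- The length bound up to `N` uses only the earlier iterates, so strong induction closes the loop.
  have hball : ∀ N, x (K + N + 1) ∈ Metric.ball xs ρ := by
    intro N
    induction N using Nat.strong_induction_on with
    | _ N ih =>
      have h1 := hlen N ih
      have h2 := dist_le_range_sum_dist (fun k => x (K + k + 1)) N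
      have h3 : ∑ i ∈ Finset.range N, dist (x (K + i + 1)) (x (K + (i + 1) + 1)) =
          ∑ k ∈ Finset.range N, d (K + (k + 1)) :=
        Finset.sum_congr rfl fun i _ => by rw [dist_comm, dist_eq_norm, hd]; rfl
      have h4 := dist_triangle4_right (x (K + N + 1)) xs (x (K + 0 + 1)) (x K)
      rw [Metric.mem_ball] at hKx ⊢
      have h5 : dist (x (K + 1)) (x K) = d K := dist_eq_norm _ _
      have h6 := dist_triangle (x (K + N + 1)) (x (K + 1)) xs
      have h7 := dist_triangle (x (K + 1)) (x K) xs
      rw [dist_comm] at h2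
      have h8 : Φ 0 < ρ / 4 := hKφ
      simp only [add_zero] at h2
      linarith
  refine (summable_nat_add_iff (K + 1)).1 ?_
  refine summable_of_sum_range_le (fun _ => norm_nonneg _) (c := d K + Φ 0) fun N => ?_
  refine le_trans (le_of_eq (Finset.sum_congr rfl fun i _ => ?_)) (hlen N fun k _ => hball k)
  rw [show i + (K + 1) = K + (i + 1) by omega]

end KurdykaLojasiewicz

/-! ### The action of the mixing matrix on stacked vectors -/

section MulMat

variable {n p : ℕ}

theorem mulMat_apply (A : Matrix (Fin n) (Fin n) ℝ) (x : Mat n p) (i : Fin n) :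
    mulMat A x i = ∑ j, A i j • x j := rfl

theorem mulMat_add (A : Matrix (Fin n) (Fin n) ℝ) (x y : Mat n p) :
    mulMat A (x + y) = mulMat A x + mulMat A y := by
  ext i : 1
  simp only [mulMat_apply, PiLp.add_apply, smul_add, Finset.sum_add_distrib]

theorem mulMat_smul (A : Matrix (Fin n) (Fin n) ℝ) (c : ℝ) (x : Mat n p) :
    mulMat A (c • x) = c • mulMat A x := by
  ext i : 1
  simp only [mulMat_apply, PiLp.smul_apply, Finset.smul_sum, smul_comm c]

theorem mulMat_sub (A : Matrix (Fin n) (Fin n) ℝ) (x y : Mat n p) :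
    mulMat A (x - y) = mulMat A x - mulMat A y := by
  ext i : 1
  simp only [mulMat_apply, PiLp.sub_apply, smul_sub, Finset.sum_sub_distrib]

theorem mulMat_one (x : Mat n p) : mulMat 1 x = x := by
  ext i : 1
  simp [mulMat_apply, Matrix.one_apply]

theorem sub_mulMat (A B : Matrix (Fin n) (Fin n) ℝ) (x : Mat n p) :
    mulMat (A - B) x = mulMat A x - mulMat B x := by
  ext i : 1
  simp [mulMat_apply, sub_smul]

theorem smul_mulMat (c : ℝ) (A : Matrix (Fin n) (Fin n) ℝ) (x : Mat n p) :
    mulMat (c • A) x = c • mulMat A x := by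
  ext i : 1
  simp [mulMat_apply, Finset.smul_sum, mul_smul]

theorem mulMat_mulMat (A B : Matrix (Fin n) (Fin n) ℝ) (x : Mat n p) :
    mulMat A (mulMat B x) = mulMat (A * B) x := by
  ext i : 1
  simp only [mulMat_apply, Matrix.mul_apply, Finset.smul_sum, Finset.sum_smul, mul_smul]
  exact Finset.sum_comm

theorem inner_mulMat_right (A : Matrix (Fin n) (Fin n) ℝ) (x y : Mat n p) :
    inner ℝ x (mulMat A y) = ∑ i, ∑ j, A i j * inner ℝ (x i) (y j) := by
  rw [PiLp.inner_apply]
  refine Finset.sum_congr rfl fun i _ => ?_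
  rw [mulMat_apply, inner_sum]
  exact Finset.sum_congr rfl fun j _ => real_inner_smul_right _ _ _

theorem inner_mulMat_left {A : Matrix (Fin n) (Fin n) ℝ} (hA : A.IsHermitian) (x y : Mat n p) :
    inner ℝ (mulMat A x) y = inner ℝ x (mulMat A y) := by
  rw [real_inner_comm, inner_mulMat_right, inner_mulMat_right, Finset.sum_comm]
  refine Finset.sum_congr rfl fun i _ => Finset.sum_congr rfl fun j _ => ?_
  rw [← hA.apply j i, real_inner_comm, star_trivial]

/-- Working column by column transfers positivity of `A` on ℝⁿ to its action on ℝ^{n×p}. -/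
theorem inner_mulMat_eq_sum (A : Matrix (Fin n) (Fin n) ℝ) (x : Mat n p) :
    inner ℝ x (mulMat A x) =
      ∑ c, dotProduct (fun i => x i c) (A.mulVec fun i => x i c) := by
  rw [inner_mulMat_right]
  simp only [dotProduct, Matrix.mulVec, PiLp.inner_apply, Finset.mul_sum]
  rw [Finset.sum_comm (s := (Finset.univ : Finset (Fin p)))]
  refine Finset.sum_congr rfl fun i _ => ?_
  rw [Finset.sum_comm]
  refine Finset.sum_congr rfl fun c _ => Finset.sum_congr rfl fun j _ => ?_
  simp only [RCLike.inner_apply, conj_trivial]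
  ring

theorem inner_mulMat_nonneg {A : Matrix (Fin n) (Fin n) ℝ} (hA : A.PosSemidef) (x : Mat n p) :
    0 ≤ inner ℝ x (mulMat A x) := by
  rw [inner_mulMat_eq_sum]
  exact Finset.sum_nonneg fun c _ => by simpa using hA.dotProduct_mulVec_nonneg (fun i => x i c)

/-- The congruences (1 − W)(1 + W)(1 − W) and (1 + W)(1 − W)(1 + W) are positive semidefinite and
sum to 2(1 − W²), so W² ⪯ 1. -/
theorem norm_mulMat_le {W : Matrix (Fin n) (Fin n) ℝ} (hW : W.IsHermitian)
    (h1 : (1 - W).PosSemidef) (h2 : (W + 1).PosSemidef) (x : Mat n p) :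
    ‖mulMat W x‖ ≤ ‖x‖ := by
  have h3 : ((1 - W) * (W + 1) * (1 - W) + (W + 1) * (1 - W) * (W + 1)).PosSemidef := by
    have ha := h2.mul_mul_conjTranspose_same (1 - W)
    have hb := h1.mul_mul_conjTranspose_same (W + 1)
    rw [h1.1.eq] at ha
    rw [h2.1.eq] at hb
    exact ha.add hb
  have h4 : (1 - W) * (W + 1) * (1 - W) + (W + 1) * (1 - W) * (W + 1) =
      (2 : ℝ) • ((1 : Matrix (Fin n) (Fin n) ℝ) - W * W) := by
    rw [two_smul]; noncomm_ring
  have h5 := inner_mulMat_nonneg h3 x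
  rw [h4, smul_mulMat, sub_mulMat, mulMat_one, ← mulMat_mulMat, inner_smul_right, inner_sub_right,
    ← inner_mulMat_left hW, real_inner_self_eq_norm_sq, real_inner_self_eq_norm_sq] at h5
  exact abs_le_of_sq_le_sq (by linarith) (norm_nonneg x) |>.trans' (le_abs_self _)

theorem posSemidef_sub_lambdaMin {W : Matrix (Fin n) (Fin n) ℝ} (hW : W.IsHermitian) :
    (W - lambdaMin hW • (1 : Matrix (Fin n) (Fin n) ℝ)).PosSemidef := by
  have hH : (W - lambdaMin hW • (1 : Matrix (Fin n) (Fin n) ℝ)).IsHermitian :=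
    hW.sub (by simp [Matrix.IsHermitian])
  rw [hH.posSemidef_iff_eigenvalues_nonneg]
  intro i
  have h1 : ∀ μ ∈ spectrum ℝ (W - lambdaMin hW • (1 : Matrix (Fin n) (Fin n) ℝ)), 0 ≤ μ := by
    intro μ hμ
    rw [← Algebra.algebraMap_eq_smul_one, sub_eq_add_neg, add_comm, ← map_neg,
      ← sub_add_cancel μ (-lambdaMin hW), spectrum.add_mem_add_iff, sub_neg_eq_add,
      hW.spectrum_real_eq_range_eigenvalues] at hμ
    obtain ⟨j, hj⟩ := hμ
    have : lambdaMin hW ≤ hW.eigenvalues j := ciInf_le (Finite.bddBelow_range _) j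
    linarith
  exact h1 _ (hH.eigenvalues_mem_spectrum_real i)

theorem lambdaMin_le_one [NeZero n] {W : Matrix (Fin n) (Fin n) ℝ} (hW : W.IsHermitian)
    (h : (1 - W).PosSemidef) : lambdaMin hW ≤ 1 := by
  -- The sum of the two matrices is (1 − λ_n)I, whose diagonal entries are nonnegative.
  have h1 := (h.add (posSemidef_sub_lambdaMin hW)).diag_nonneg (i := 0)
  simp at h1
  linarith

theorem lambdaMin_mul_norm_sq_le {W : Matrix (Fin n) (Fin n) ℝ} (hW : W.IsHermitian)
    (x : Mat n p) : lambdaMin hW * ‖x‖ ^ 2 ≤ inner ℝ x (mulMat W x) := by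
  have := inner_mulMat_nonneg (posSemidef_sub_lambdaMin hW) x
  rw [sub_mulMat, smul_mulMat, mulMat_one, inner_sub_right, inner_smul_right,
    real_inner_self_eq_norm_sq] at this
  linarith

theorem rowAvg_add (x y : Mat n p) : rowAvg (x + y) = rowAvg x + rowAvg y := by
  simp [rowAvg, Finset.sum_add_distrib]

theorem norm_rowAvg_le (x : Mat n p) : ‖rowAvg x‖ ≤ ‖x‖ := by
  rcases Nat.eq_zero_or_pos n with rfl | hn
  · simp [rowAvg]
  rw [rowAvg, norm_smul, norm_inv, RCLike.norm_natCast, inv_mul_le_iff₀ (by positivity)]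
  refine (norm_sum_le _ _).trans ((Finset.sum_le_sum fun i _ => PiLp.norm_apply_le x i).trans ?_)
  simp

/-- The vector 1 is in the kernel of the symmetric matrix I − W, so its column sums vanish.
Averaging over nodes thus removes the consensus term from ∇L_α. -/
theorem rowAvg_one_sub_mulMat {G : SimpleGraph (Fin n)} {W : Matrix (Fin n) (Fin n) ℝ}
    (hW : IsMixing G W) (x : Mat n p) : rowAvg (mulMat (1 - W) x) = 0 := by
  have h1 : (1 - W).mulVec (fun _ => (1 : ℝ)) = 0 := by
    have : (fun _ => (1 : ℝ)) ∈ LinearMap.ker (Matrix.toLin' (1 - W)) := by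
      rw [hW.null_space]; exact Submodule.mem_span_singleton_self _
    rwa [LinearMap.mem_ker, Matrix.toLin'_apply] at this
  have h2 : ∀ j, ∑ i, (1 - W) i j = 0 := fun j => by
    have := congrFun h1 j
    simp only [Matrix.mulVec, dotProduct, mul_one, Pi.zero_apply] at this
    rw [← this]
    exact Finset.sum_congr rfl fun i _ => by
      rw [← hW.le_one.1.apply i j]; rfl
  simp only [rowAvg, mulMat_apply]
  rw [Finset.sum_comm]
  simp only [← Finset.sum_smul, h2, zero_smul, Finset.sum_const_zero, smul_zero]

end MulMat

/-! ### The smooth part L_α: gradient, descent, residual -/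

section Smooth

variable {n p : ℕ}

theorem le_iSup_fin (L : Fin n → ℝ) (i : Fin n) : L i ≤ ⨆ i, L i :=
  le_ciSup (Finite.bddAbove_range L) i

theorem norm_gradF_sub_le {f : Fin n → Vec p → ℝ} {L : ℝ} (hL0 : 0 ≤ L)
    (hL : ∀ i u v, ‖gradient (f i) u - gradient (f i) v‖ ≤ L * ‖u - v‖) (x y : Mat n p) :
    ‖gradF f x - gradF f y‖ ≤ L * ‖x - y‖ := by
  refine le_trans (le_abs_self _) (abs_le_of_sq_le_sq ?_ (by positivity))
  rw [mul_pow, PiLp.norm_sq_eq_of_L2, PiLp.norm_sq_eq_of_L2, Finset.mul_sum]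
  refine Finset.sum_le_sum fun i _ => ?_
  rw [← mul_pow]
  exact pow_le_pow_left₀ (norm_nonneg _) (hL i (x i) (y i)) 2

theorem inner_one_sub_mulMat_le {W : Matrix (Fin n) (Fin n) ℝ} (hW : W.IsHermitian)
    (x : Mat n p) : inner ℝ x (mulMat (1 - W) x) ≤ (1 - lambdaMin hW) * ‖x‖ ^ 2 := by
  have := lambdaMin_mul_norm_sq_le hW x
  rw [sub_mulMat, mulMat_one, inner_sub_right, real_inner_self_eq_norm_sq]
  linarith

theorem inner_mulMat_self_eq {A : Matrix (Fin n) (Fin n) ℝ} (hA : A.IsHermitian) (x y : Mat n p) :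
    inner ℝ y (mulMat A y) = inner ℝ x (mulMat A x) +
      2 * inner ℝ (mulMat A x) (y - x) + inner ℝ (y - x) (mulMat A (y - x)) := by
  obtain ⟨d, rfl⟩ : ∃ d, y = x + d := ⟨y - x, by abel⟩
  have hc := inner_mulMat_left hA x d
  have hc' := real_inner_comm (mulMat A x) d
  rw [add_sub_cancel_left, mulMat_add, inner_add_left, inner_add_right, inner_add_right]
  linarith

/-- The second-order expansion is exact; its remainder lies between 0 and (1 − λ_n)‖y − x‖². -/
theorem hasGradientAt_inner_mulMat_self {W : Matrix (Fin n) (Fin n) ℝ} (hW : W.IsHermitian)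
    (hW1 : (1 - W).PosSemidef) (x : Mat n p) :
    HasGradientAt (fun y : Mat n p => inner ℝ y (mulMat (1 - W) y))
      ((2 : ℝ) • mulMat (1 - W) x) x := by
  rw [hasGradientAt_iff_isLittleO]
  refine Asymptotics.IsBigO.trans_isLittleO (g := fun y => ‖y - x‖ ^ 2)
    (Asymptotics.IsBigO.of_bound (1 - lambdaMin hW) (Eventually.of_forall fun y => ?_)) ?_
  · rw [inner_mulMat_self_eq hW1.1 x y, real_inner_smul_left, add_assoc, add_sub_cancel_left,
      add_sub_cancel_left, Real.norm_of_nonneg (inner_mulMat_nonneg hW1 _),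
      Real.norm_of_nonneg (sq_nonneg _)]
    exact inner_one_sub_mulMat_le hW _
  · have h1 : Tendsto (fun y => y - x) (𝓝 x) (𝓝 0) := by
      have : Continuous (fun y => y - x) := by fun_prop
      simpa using this.tendsto x
    exact (Asymptotics.isLittleO_norm_pow_id one_lt_two).comp_tendsto h1

theorem hasGradientAt_lyap {f : Fin n → Vec p → ℝ} (hf : ∀ i, Differentiable ℝ (f i))
    {W : Matrix (Fin n) (Fin n) ℝ} (hW : W.IsHermitian) (hW1 : (1 - W).PosSemidef)
    (α : ℝ) (x : Mat n p) :
    HasGradientAt (lyap f W α) (gradF f x + α⁻¹ • mulMat (1 - W) x) x := by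
  have h1 : HasFDerivAt (fun y : Mat n p => ∑ i, f i (y i))
      (∑ i, (fderiv ℝ (f i) (x i)).comp (PiLp.proj 2 (fun _ : Fin n => Vec p) i)) x := by
    refine HasFDerivAt.fun_sum fun i _ => ?_
    exact (hf i (x i)).hasFDerivAt.comp x
      (PiLp.proj (𝕜 := ℝ) 2 (fun _ : Fin n => Vec p) i).hasFDerivAt
  have h2 := (hasGradientAt_inner_mulMat_self hW hW1 x).hasFDerivAt.const_mul (1 / (2 * α))
  rw [hasGradientAt_iff_hasFDerivAt]
  refine (h1.add h2).congr_fderiv ?_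
  ext v
  have h3 : inner ℝ (gradF f x) v = ∑ i, fderiv ℝ (f i) (x i) (v i) := by
    rw [PiLp.inner_apply]
    exact Finset.sum_congr rfl fun i _ => by
      rw [(hf i (x i)).hasGradientAt.hasFDerivAt.fderiv, InnerProductSpace.toDual_apply_apply]
      rfl
  have h4 : 1 / (2 * α) * 2 = α⁻¹ := by field_simp
  rw [InnerProductSpace.toDual_apply_apply, inner_add_left, h3, real_inner_smul_left]
  simp only [add_apply, sum_apply, ContinuousLinearMap.comp_apply, PiLp.proj_apply, smul_apply, smul_eq_mul,
    InnerProductSpace.toDual_apply_apply, real_inner_smul_left]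
  rw [← mul_assoc, h4]

theorem gradient_lyap {f : Fin n → Vec p → ℝ} (hf : ∀ i, Differentiable ℝ (f i))
    {W : Matrix (Fin n) (Fin n) ℝ} (hW : W.IsHermitian) (hW1 : (1 - W).PosSemidef) (α : ℝ) (x : Mat n p) :
    gradient (lyap f W α) x = gradF f x + α⁻¹ • mulMat (1 - W) x :=
  (hasGradientAt_lyap hf hW hW1 α x).gradient

/-- The forward step of Prox-DGD is a gradient step for `lyap`. -/
theorem sub_smul_gradient_lyap {f : Fin n → Vec p → ℝ} (hf : ∀ i, Differentiable ℝ (f i))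
    {W : Matrix (Fin n) (Fin n) ℝ} (hW : W.IsHermitian) (hW1 : (1 - W).PosSemidef) {α : ℝ} (hα : α ≠ 0) (x : Mat n p) :
    x - α • gradient (lyap f W α) x = mulMat W x - α • gradF f x := by
  rw [gradient_lyap hf hW hW1, smul_add, smul_smul, mul_inv_cancel₀ hα, one_smul, sub_mulMat,
    mulMat_one]
  abel

/-- The descent lemma is applied row by row to the `f i`, while the quadratic term is expanded
exactly; its curvature is at most α⁻¹(1 − λ_n). -/
theorem lyap_descent {f : Fin n → Vec p → ℝ} (hf : ∀ i, Differentiable ℝ (f i)) {L : ℝ}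
    (hL : ∀ i u v, ‖gradient (f i) u - gradient (f i) v‖ ≤ L * ‖u - v‖)
    {W : Matrix (Fin n) (Fin n) ℝ} (hW : W.IsHermitian) (hW1 : (1 - W).PosSemidef) {α : ℝ} (hα : 0 < α) (x y : Mat n p) :
    lyap f W α y ≤ lyap f W α x + inner ℝ (gradient (lyap f W α) x) (y - x) +
      (L + α⁻¹ * (1 - lambdaMin hW)) / 2 * ‖y - x‖ ^ 2 := by
  have h1 : ∑ i, f i (y i) ≤ ∑ i, f i (x i) + inner ℝ (gradF f x) (y - x) +
      L / 2 * ‖y - x‖ ^ 2 := by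
    rw [PiLp.inner_apply, PiLp.norm_sq_eq_of_L2, Finset.mul_sum, ← Finset.sum_add_distrib,
      ← Finset.sum_add_distrib]
    exact Finset.sum_le_sum fun i _ =>
      le_add_inner_add_of_lipschitz_gradient (hf i) (hL i) (x i) (y i)
  have h2 := inner_mulMat_self_eq hW1.1 x y
  have h3 := inner_one_sub_mulMat_le hW (y - x)
  rw [gradient_lyap hf hW hW1, lyap, lyap, h2, inner_add_left, real_inner_smul_left]
  have h4 := mul_le_mul_of_nonneg_left h3 (by positivity : 0 ≤ 1 / (2 * α))
  have h5 : 1 / (2 * α) = α⁻¹ / 2 := by field_simp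
  rw [h5] at h4 ⊢
  linarith

/-- The residual of the proximal step, written through the difference of two iterates. -/
theorem norm_gradient_lyap_add_le {f : Fin n → Vec p → ℝ} (hf : ∀ i, Differentiable ℝ (f i))
    {L : ℝ} (hL0 : 0 ≤ L)
    (hL : ∀ i u v, ‖gradient (f i) u - gradient (f i) v‖ ≤ L * ‖u - v‖)
    {W : Matrix (Fin n) (Fin n) ℝ} (hW : W.IsHermitian) (hW1 : (1 - W).PosSemidef) 
    (h2 : (W + 1).PosSemidef) {α : ℝ} (hα : 0 < α) {x y ξ : Mat n p}
    (hξ : y + α • ξ = mulMat W x - α • gradF f x) :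
    ‖gradient (lyap f W α) y + ξ‖ ≤ (α⁻¹ + L) * ‖y - x‖ := by
  have hξ' : ξ = α⁻¹ • (mulMat W x - y) - gradF f x := by
    have : α • ξ = mulMat W x - α • gradF f x - y := by rw [← hξ]; abel
    rw [← inv_smul_smul₀ hα.ne' ξ, this, sub_right_comm, smul_sub, inv_smul_smul₀ hα.ne']
  -- The terms α⁻¹y cancel, which leaves only differences of the two iterates.
  have h3 : gradient (lyap f W α) y + ξ =
      (gradF f y - gradF f x) + α⁻¹ • mulMat W (x - y) := by
    rw [gradient_lyap hf hW hW1, hξ', sub_mulMat, mulMat_one, mulMat_sub]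
    simp only [smul_sub]
    abel
  rw [h3]
  refine (norm_add_le _ _).trans ?_
  rw [norm_smul, norm_inv, Real.norm_of_nonneg hα.le, add_mul, add_comm (α⁻¹ * _)]
  refine add_le_add (norm_gradF_sub_le hL0 hL y x) ?_
  rw [norm_sub_rev y x]
  exact mul_le_mul_of_nonneg_left (norm_mulMat_le hW hW1 h2 _) (by positivity)

end Smooth

/-! ### Continuity of values along proximal points -/

section ProxGradient

/-- The function value is continuous along a convergent subsequence of a proximal gradient
method. -/
theorem eq_of_tendsto_proxSet {E : Type*} [NormedAddCommGroup E] {α : ℝ} (hα : 0 < α) {g : E → ℝ} {r : E → EReal}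
    (hbot : ∀ x, r x ≠ ⊥) (hlsc : LowerSemicontinuous fun x => (g x : EReal) + r x)
    (hg : Continuous g) {u z : ℕ → E} {us zs : E} (hprox : ∀ k, u k ∈ proxSet α r (z k))
    (hu : Tendsto u atTop (𝓝 us)) (hz : Tendsto z atTop (𝓝 zs)) {H : ℕ → ℝ} {Hs : ℝ}
    (hH : ∀ k, (g (u k) : EReal) + r (u k) = H k) (hlim : Tendsto H atTop (𝓝 Hs)) :
    (g us : EReal) + r us = Hs := by
  have hle : (g us : EReal) + r us ≤ Hs := by
    refine le_of_forall_lt fun y hy => ?_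
    obtain ⟨y', hyy', hy'⟩ := exists_between hy
    have h1 := hu.eventually (hlsc us y' hy')
    have h2 : Tendsto (fun k => (H k : EReal)) atTop (𝓝 (Hs : EReal)) :=
      EReal.tendsto_coe.2 hlim
    refine hyy'.trans_le (ge_of_tendsto h2 ?_)
    filter_upwards [h1] with k hk
    rw [← hH k]; exact hk.le
  have htop : r us ≠ ⊤ := by
    intro h
    rw [h, EReal.coe_add_top, top_le_iff] at hle
    exact EReal.coe_ne_top _ hle
  have hbots := hbot us
  have hval : ∀ k, r (u k) ≠ ⊤ ∧ (r (u k)).toReal = H k - g (u k) := by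
    intro k
    have h1 := hH k
    have h2 := hbot (u k)
    induction hr : r (u k) with
    | bot => exact absurd hr h2
    | top => rw [hr, EReal.coe_add_top] at h1; exact absurd h1.symm (EReal.coe_ne_top _)
    | coe t =>
      rw [hr] at h1
      have h3 : g (u k) + t = H k := by exact_mod_cast h1
      exact ⟨EReal.coe_ne_top _, by rw [EReal.toReal_coe]; linarith⟩
  -- Minimality tested against the limit `us`; both quadratic terms have the same limit and cancel,
  -- leaving Hs − g(us) ≤ r(us).
  have key : ∀ k, α * (H k - g (u k)) + ‖u k - z k‖ ^ 2 / 2 ≤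
      α * (r us).toReal + ‖us - z k‖ ^ 2 / 2 := fun k => by
    rw [← (hval k).2]
    exact toReal_le_of_mem_proxSet (hprox k) (hval k).1 (hbot _) htop hbots
  have h1 : Tendsto (fun k => α * (H k - g (u k)) + ‖u k - z k‖ ^ 2 / 2) atTop
      (𝓝 (α * (Hs - g us) + ‖us - zs‖ ^ 2 / 2)) :=
    ((hlim.sub ((hg.tendsto us).comp hu)).const_mul α).add
      (((hu.sub hz).norm.pow 2).div_const 2)
  have h2 : Tendsto (fun k => α * (r us).toReal + ‖us - z k‖ ^ 2 / 2) atTop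
      (𝓝 (α * (r us).toReal + ‖us - zs‖ ^ 2 / 2)) :=
    tendsto_const_nhds.add (((tendsto_const_nhds.sub hz).norm.pow 2).div_const 2)
  have h3 := le_of_tendsto_of_tendsto' h1 h2 key
  have h4 : Hs - g us ≤ (r us).toReal := le_of_mul_le_mul_left (by linarith) hα
  lift r us to ℝ using ⟨htop, hbots⟩ with t ht
  rw [EReal.toReal_coe] at h4
  have h5 : g us + t ≤ Hs := by exact_mod_cast hle
  have h6 : g us + t = Hs := by linarith
  exact_mod_cast h6

end ProxGradient

/-! ### Finite sums of extended reals -/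

section ERealSum

variable {ι : Type*}

theorem ereal_sum_ne_bot {s : Finset ι} {F : ι → EReal} (h : ∀ i ∈ s, F i ≠ ⊥) :
    ∑ i ∈ s, F i ≠ ⊥ := by
  classical
  induction s using Finset.induction_on with
  | empty => simp
  | insert a s ha ih =>
    rw [Finset.sum_insert ha, EReal.add_ne_bot_iff]
    exact ⟨h a (Finset.mem_insert_self a s), ih fun i hi => h i (Finset.mem_insert_of_mem hi)⟩

theorem ereal_ne_top_of_sum_ne_top {s : Finset ι} {F : ι → EReal} (h : ∀ i, F i ≠ ⊥)
    (hs : ∑ i ∈ s, F i ≠ ⊤) : ∀ i ∈ s, F i ≠ ⊤ := by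
  classical
  intro i hi htop
  rw [← Finset.add_sum_erase s F hi, htop,
    EReal.top_add_of_ne_bot (ereal_sum_ne_bot fun j _ => h j)] at hs
  exact hs rfl

theorem ereal_coe_sum (s : Finset ι) (F : ι → ℝ) :
    ((∑ i ∈ s, F i : ℝ) : EReal) = ∑ i ∈ s, (F i : EReal) := by
  classical
  induction s using Finset.induction_on with
  | empty => simp
  | insert a s ha ih => rw [Finset.sum_insert ha, Finset.sum_insert ha, EReal.coe_add, ih]

theorem ereal_sum_eq_coe {s : Finset ι} {F : ι → EReal} (h : ∀ i ∈ s, F i ≠ ⊥)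
    (h' : ∀ i ∈ s, F i ≠ ⊤) : ∑ i ∈ s, F i = ((∑ i ∈ s, (F i).toReal : ℝ) : EReal) := by
  rw [ereal_coe_sum]
  exact Finset.sum_congr rfl fun i hi => (EReal.coe_toReal (h' i hi) (h i hi)).symm

theorem lowerSemicontinuous_ereal_sum {X : Type*} [TopologicalSpace X] {s : Finset ι}
    {F : ι → X → EReal} (hbot : ∀ i x, F i x ≠ ⊥) (h : ∀ i, LowerSemicontinuous (F i)) :
    LowerSemicontinuous fun x => ∑ i ∈ s, F i x := by
  classical
  induction s using Finset.induction_on with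
  | empty => simpa using lowerSemicontinuous_const
  | insert a s ha ih =>
    simp only [Finset.sum_insert ha]
    exact (h a).add' ih fun x => EReal.continuousAt_add
      (.inr (ereal_sum_ne_bot fun i _ => hbot i x)) (.inl (hbot a x))

end ERealSum

/-! ### Coercive functions -/

section Coercive

theorem Coercive.isBounded_le {E : Type*} [NormedAddCommGroup E] {h : E → EReal} (hc : Coercive h) (M : ℝ) :
    Bornology.IsBounded {x | h x ≤ M} := by
  have h1 : ∀ᶠ x in Bornology.cobounded E, (M : EReal) < h x :=
    hc.eventually (lt_mem_nhds (EReal.coe_lt_top M))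
  rw [← Bornology.isCobounded_compl_iff]
  filter_upwards [h1] with x hx using not_le.2 hx

theorem Coercive.exists_le {E : Type*} [NormedAddCommGroup E] [ProperSpace E] {h : E → EReal} (hc : Coercive h)
    (hlsc : LowerSemicontinuous h) (hbot : ∀ x, h x ≠ ⊥) : ∃ c : ℝ, ∀ x, (c : EReal) ≤ h x := by
  obtain ⟨R, hR⟩ := (hc.isBounded_le 0).subset_closedBall 0
  rcases (Metric.closedBall (0 : E) R).eq_empty_or_nonempty with he | hne
  · refine ⟨0, fun x => ?_⟩
    by_contra hx
    have := hR (show h x ≤ ((0 : ℝ) : EReal) from (not_le.1 hx).le)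
    rw [he] at this
    exact this
  obtain ⟨x₀, -, hx₀⟩ := (hlsc.lowerSemicontinuousOn _).exists_isMinOn hne
    (isCompact_closedBall (0 : E) R)
  -- The minimum with 0 covers points outside the ball, where `h` is positive, and stays finite even
  -- if `h x₀` is +∞.
  have hb : ⊥ < min (h x₀) 0 := lt_min (bot_lt_iff_ne_bot.2 (hbot x₀)) (EReal.bot_lt_coe 0)
  obtain ⟨c, -, hc'⟩ := EReal.lt_iff_exists_real_btwn.1 hb
  refine ⟨c, fun x => ?_⟩
  by_cases hx : x ∈ Metric.closedBall (0 : E) R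
  · exact (hc'.le.trans (min_le_left _ _)).trans (hx₀ hx)
  · have : ¬ h x ≤ ((0 : ℝ) : EReal) := fun h0 => hx (hR h0)
    exact (hc'.le.trans (min_le_right _ _)).trans (not_le.1 this).le

end Coercive

/-! ### Lower semicontinuity, convexity and coercivity of the composite objective -/

section Composite

variable {n p : ℕ} {f : Fin n → Vec p → ℝ} {r : Fin n → Vec p → EReal} {Lf : Fin n → ℝ}

theorem IsCompositeObjective.ne_bot (h : IsCompositeObjective f r Lf) (i : Fin n) (u : Vec p) :
    r i u ≠ ⊥ :=
  (EReal.add_ne_bot_iff.1 ((h.proper i).1 u)).2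

theorem IsCompositeObjective.rSum_ne_bot (h : IsCompositeObjective f r Lf) (x : Mat n p) :
    rSum r x ≠ ⊥ :=
  ereal_sum_ne_bot fun i _ => h.ne_bot i _

theorem IsCompositeObjective.exists_rSum_ne_top (h : IsCompositeObjective f r Lf) :
    ∃ x : Mat n p, rSum r x ≠ ⊤ := by
  choose u hu using fun i => (h.proper i).2
  refine ⟨WithLp.toLp 2 u, ?_⟩
  have h1 : ∀ i, r i (u i) ≠ ⊤ := fun i htop => hu i (by
    simp only [htop, EReal.coe_add_top])
  rw [rSum, ereal_sum_eq_coe (fun i _ => h.ne_bot i _) (fun i _ => h1 i)]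
  exact EReal.coe_ne_top _

theorem IsCompositeObjective.apply_ne_top (h : IsCompositeObjective f r Lf) {x : Mat n p}
    (hx : rSum r x ≠ ⊤) (i : Fin n) : r i (x i) ≠ ⊤ :=
  ereal_ne_top_of_sum_ne_top (F := fun i => r i (x i)) (fun i => h.ne_bot i _) hx i
    (Finset.mem_univ i)

theorem IsCompositeObjective.toReal_rSum (h : IsCompositeObjective f r Lf) {x : Mat n p}
    (hx : rSum r x ≠ ⊤) : (rSum r x).toReal = ∑ i, (r i (x i)).toReal := by
  rw [rSum, ereal_sum_eq_coe (fun i _ => h.ne_bot i _) (fun i _ => h.apply_ne_top hx i),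
    EReal.toReal_coe]

theorem IsCompositeObjective.lipschitz_iSup (h : IsCompositeObjective f r Lf) (i : Fin n)
    (u v : Vec p) : ‖gradient (f i) u - gradient (f i) v‖ ≤ (⨆ i, Lf i) * ‖u - v‖ :=
  (h.lipschitz i u v).trans (mul_le_mul_of_nonneg_right (le_iSup_fin Lf i) (norm_nonneg _))

theorem lyapHat_eq (W : Matrix (Fin n) (Fin n) ℝ) (α : ℝ) (x : Mat n p) :
    lyapHat f r W α x = ((1 / (2 * α) * inner ℝ x (mulMat (1 - W) x) : ℝ) : EReal) +
      ∑ i, ((f i (x i) : EReal) + r i (x i)) := by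
  rw [lyapHat, lyap, EReal.coe_add, ereal_coe_sum, Finset.sum_add_distrib, rSum, ← add_assoc,
    add_comm (∑ i, (f i (x i) : EReal))]

theorem IsCompositeObjective.lowerSemicontinuous_lyapHat (h : IsCompositeObjective f r Lf)
    {W : Matrix (Fin n) (Fin n) ℝ} (hW : W.IsHermitian) (hW1 : (1 - W).PosSemidef) (α : ℝ) :
    LowerSemicontinuous (lyapHat (p := p) f r W α) := by
  have h1 : Continuous fun x : Mat n p =>
      ((1 / (2 * α) * inner ℝ x (mulMat (1 - W) x) : ℝ) : EReal) := by
    refine continuous_coe_real_ereal.comp (continuous_const.mul ?_)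
    exact continuous_iff_continuousAt.2 fun x =>
      (hasGradientAt_inner_mulMat_self hW hW1 x).continuousAt
  have h2 : LowerSemicontinuous fun x : Mat n p => ∑ i, ((f i (x i) : EReal) + r i (x i)) :=
    lowerSemicontinuous_ereal_sum (F := fun i (x : Mat n p) => (f i (x i) : EReal) + r i (x i))
      (fun i x => (h.proper i).1 (x i))
      fun i => (h.lsc i).comp (PiLp.continuous_apply 2 (fun _ : Fin n => Vec p) i)
  have h3 := h1.lowerSemicontinuous.add' h2 fun x => EReal.continuousAt_add
    (.inl (EReal.coe_ne_top _)) (.inl (EReal.coe_ne_bot _))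
  exact (funext fun x => lyapHat_eq W α x : lyapHat f r W α = _) ▸ h3

/-- Along a segment between points of finite value, `rSum` satisfies the convexity inequality. -/
theorem IsCompositeObjective.rSum_segment (h : IsCompositeObjective f r Lf)
    (hconv : ∀ i, ExtConvex (r i)) {x y : Mat n p} (hx : rSum r x ≠ ⊤) (hy : rSum r y ≠ ⊤)
    {t : ℝ} (ht : 0 < t) (ht1 : t < 1) :
    rSum r (x + t • (y - x)) ≠ ⊤ ∧ (rSum r (x + t • (y - x))).toReal ≤
      (1 - t) * (rSum r x).toReal + t * (rSum r y).toReal := by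
  have key : ∀ i, r i ((x + t • (y - x)) i) ≤
      (((1 - t) * (r i (x i)).toReal + t * (r i (y i)).toReal : ℝ) : EReal) := by
    intro i
    have h1 : (x i, (r i (x i)).toReal) ∈ {q : Vec p × ℝ | r i q.1 ≤ (q.2 : EReal)} :=
      EReal.le_coe_toReal (h.apply_ne_top hx i)
    have h2 : (y i, (r i (y i)).toReal) ∈ {q : Vec p × ℝ | r i q.1 ≤ (q.2 : EReal)} :=
      EReal.le_coe_toReal (h.apply_ne_top hy i)
    have h3 := hconv i h1 h2 (sub_nonneg.2 ht1.le) ht.le (sub_add_cancel 1 t)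
    have h4 : (x + t • (y - x)) i = (1 - t) • x i + t • y i := by
      simp only [PiLp.add_apply, PiLp.smul_apply, PiLp.sub_apply, smul_sub, sub_smul, one_smul]
      abel
    rw [h4]
    exact h3
  have htop : ∀ i, r i ((x + t • (y - x)) i) ≠ ⊤ := fun i =>
    ne_top_of_le_ne_top (EReal.coe_ne_top _) (key i)
  have hne : rSum r (x + t • (y - x)) ≠ ⊤ := by
    rw [rSum, ereal_sum_eq_coe (fun i _ => h.ne_bot i _) (fun i _ => htop i)]
    exact EReal.coe_ne_top _
  refine ⟨hne, ?_⟩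
  rw [h.toReal_rSum hne, h.toReal_rSum hx, h.toReal_rSum hy, Finset.mul_sum, Finset.mul_sum,
    ← Finset.sum_add_distrib]
  refine Finset.sum_le_sum fun i _ => ?_
  have := key i
  rwa [← EReal.coe_toReal (htop i) (h.ne_bot i _), EReal.coe_le_coe_iff] at this

/-- A sublevel set of `lyapHat` is bounded, and `lyapHat` is bounded below. -/
theorem IsCompositeObjective.isBounded_sublevel (h : IsCompositeObjective f r Lf)
    {W : Matrix (Fin n) (Fin n) ℝ} (hW1 : (1 - W).PosSemidef) {α : ℝ} (hα : 0 < α) :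
    (∃ c : ℝ, ∀ x : Mat n p, (c : EReal) ≤ lyapHat f r W α x) ∧
      ∀ M : ℝ, Bornology.IsBounded {x : Mat n p | lyapHat f r W α x ≤ M} := by
  choose c hc using fun i => (h.coercive i).exists_le (h.lsc i) (h.proper i).1
  have hq : ∀ x : Mat n p, (0 : EReal) ≤
      ((1 / (2 * α) * inner ℝ x (mulMat (1 - W) x) : ℝ) : EReal) := fun x => by
    have := inner_mulMat_nonneg hW1 x
    exact_mod_cast (by positivity : 0 ≤ 1 / (2 * α) * inner ℝ x (mulMat (1 - W) x))
  have hle : ∀ x : Mat n p, ∑ i, ((f i (x i) : EReal) + r i (x i)) ≤ lyapHat f r W α x := by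
    intro x
    rw [lyapHat_eq]
    exact le_add_of_nonneg_left (hq x)
  refine ⟨⟨∑ i, c i, fun x => ?_⟩, fun M => ?_⟩
  · rw [ereal_coe_sum]
    exact (Finset.sum_le_sum fun i _ => hc i (x i)).trans (hle x)
  -- With the other summands bounded below by `c j`, the i-th one is at most M − ∑_{j ≠ i} c j, so
  -- each row lies in a bounded sublevel set.
  · choose R hR using fun i => ((h.coercive i).isBounded_le
      (M - ∑ j ∈ Finset.univ.erase i, c j)).subset_closedBall 0
    refine (Metric.isBounded_closedBall (x := (0 : Mat n p))
      (r := √(∑ i, R i ^ 2))).subset fun x hx => ?_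
    have hx' : ∑ i, ((f i (x i) : EReal) + r i (x i)) ≤ M := (hle x).trans hx
    have hfin := ereal_ne_top_of_sum_ne_top (F := fun i => (f i (x i) : EReal) + r i (x i))
      (fun i => (h.proper i).1 (x i)) (ne_top_of_le_ne_top (EReal.coe_ne_top M) hx')
    rw [ereal_sum_eq_coe (fun i _ => (h.proper i).1 (x i)) hfin, EReal.coe_le_coe_iff] at hx'
    have hval : ∀ i, (f i (x i) : EReal) + r i (x i) =
        ((((f i (x i) : EReal) + r i (x i)).toReal : ℝ) : EReal) := fun i =>
      (EReal.coe_toReal (hfin i (Finset.mem_univ i)) ((h.proper i).1 (x i))).symm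
    have hcr : ∀ i, c i ≤ ((f i (x i) : EReal) + r i (x i)).toReal := fun i => by
      have := hc i (x i)
      rwa [hval i, EReal.coe_le_coe_iff] at this
    rw [mem_closedBall_zero_iff, PiLp.norm_eq_of_L2]
    refine Real.sqrt_le_sqrt (Finset.sum_le_sum fun i _ => ?_)
    have hmem : x i ∈ {u | (f i u : EReal) + r i u ≤
        ((M - ∑ j ∈ Finset.univ.erase i, c j : ℝ) : EReal)} := by
      rw [mem_ofPred_eq, hval i, EReal.coe_le_coe_iff]
      have h1 := Finset.add_sum_erase Finset.univ
        (fun i => ((f i (x i) : EReal) + r i (x i)).toReal) (Finset.mem_univ i)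
      have h2 := Finset.sum_le_sum (s := Finset.univ.erase i) fun j _ => hcr j
      linarith
    have := hR i hmem
    rw [mem_closedBall_zero_iff] at this
    exact pow_le_pow_left₀ (norm_nonneg _) this 2

end Composite

/-! ### Sufficient decrease and its summation -/

section Convergence

variable {n p : ℕ} {f : Fin n → Vec p → ℝ} {r : Fin n → Vec p → EReal} {Lf : Fin n → ℝ}

theorem continuous_forward_step {L : ℝ} (hL0 : 0 ≤ L)
    (hL : ∀ i u v, ‖gradient (f i) u - gradient (f i) v‖ ≤ L * ‖u - v‖)
    {W : Matrix (Fin n) (Fin n) ℝ} (hW : W.IsHermitian) (h1 : (1 - W).PosSemidef)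
    (h2 : (W + 1).PosSemidef) (α : ℝ) :
    Continuous fun x : Mat n p => mulMat W x - α • gradF f x := by
  have hA : Continuous fun x : Mat n p => mulMat W x := by
    refine (LipschitzWith.of_dist_le_mul (K := 1) fun x y => ?_).continuous
    rw [dist_eq_norm, dist_eq_norm, ← mulMat_sub, NNReal.coe_one, one_mul]
    exact norm_mulMat_le hW h1 h2 _
  have hB : Continuous fun x : Mat n p => gradF f x := by
    refine (LipschitzWith.of_dist_le_mul (K := ⟨L, hL0⟩) fun x y => ?_).continuous
    rw [dist_eq_norm, dist_eq_norm]
    exact norm_gradF_sub_le hL0 hL x y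
  exact hA.sub (hB.const_smul α)

theorem IsCompositeObjective.exists_descent [NeZero n] (h : IsCompositeObjective f r Lf)
    {W : Matrix (Fin n) (Fin n) ℝ} (hW : W.IsHermitian) (hW1 : (1 - W).PosSemidef)
    {α : ℝ} (hα : 0 < α)
    (hstep : ((∀ i, ExtConvex (r i)) ∧ α < (1 + lambdaMin hW) / (⨆ i, Lf i)) ∨
      α < lambdaMin hW / (⨆ i, Lf i)) :
    ∃ c : ℝ, 0 < c ∧ ∀ x y : Mat n p, rSum r x ≠ ⊤ →
      y ∈ proxSet α (rSum r) (mulMat W x - α • gradF f x) →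
      lyap f W α y + (rSum r y).toReal + c * ‖y - x‖ ^ 2 ≤
        lyap f W α x + (rSum r x).toReal := by
  have hLpos : 0 < ⨆ i, Lf i := (h.lip_pos 0).trans_le (le_iSup_fin Lf 0)
  -- κ measures the gain of the proximal step. Adding α times the descent inequality, which costs
  -- (αL + 1 − λ_n)‖y − x‖²/2, leaves the stated constant.
  suffices hmain : ∃ κ : ℝ, 0 < κ - 1 + lambdaMin hW - α * (⨆ i, Lf i) ∧
      ∀ x y : Mat n p, rSum r x ≠ ⊤ →
      y ∈ proxSet α (rSum r) (x - α • gradient (lyap f W α) x) →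
      α * (rSum r y).toReal + α * inner ℝ (gradient (lyap f W α) x) (y - x) +
        κ * ‖y - x‖ ^ 2 / 2 ≤ α * (rSum r x).toReal by
    obtain ⟨κ, hκ, hmain⟩ := hmain
    refine ⟨(κ - 1 + lambdaMin hW - α * (⨆ i, Lf i)) / (2 * α), by positivity,
      fun x y hx hy => ?_⟩
    rw [← sub_smul_gradient_lyap h.differentiable hW hW1 hα.ne'] at hy
    have h1 := hmain x y hx hy
    have h2 := lyap_descent h.differentiable h.lipschitz_iSup hW hW1 hα x y
    refine le_of_mul_le_mul_left ?_ hα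
    have h3 := mul_le_mul_of_nonneg_left h2 hα.le
    have h4 : α * ((κ - 1 + lambdaMin hW - α * (⨆ i, Lf i)) / (2 * α) * ‖y - x‖ ^ 2) =
        (κ - 1 + lambdaMin hW - α * (⨆ i, Lf i)) / 2 * ‖y - x‖ ^ 2 := by field_simp
    have h5 : α * (((⨆ i, Lf i) + α⁻¹ * (1 - lambdaMin hW)) / 2 * ‖y - x‖ ^ 2) =
        (α * (⨆ i, Lf i) + (1 - lambdaMin hW)) / 2 * ‖y - x‖ ^ 2 := by field_simp
    linarith
  obtain ⟨x₀, hx₀⟩ := h.exists_rSum_ne_top (p := p)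
  rcases hstep with ⟨hconv, hlt⟩ | hlt <;> rw [lt_div_iff₀ hLpos] at hlt
  -- Convex case: the variational inequality tested at `x` gives a full ‖y − x‖².
  · refine ⟨2, by linarith, fun x y hx hy => ?_⟩
    have hy' := ne_top_of_mem_proxSet hα hy hx₀ (h.rSum_ne_bot x₀)
    have h1 := inner_le_of_mem_proxSet_of_convex hy hy' (h.rSum_ne_bot y)
      (fun t ht ht1 => ⟨(h.rSum_segment hconv hy' hx ht ht1).1, h.rSum_ne_bot _,
        (h.rSum_segment hconv hy' hx ht ht1).2⟩) hα
    rw [show x - α • gradient (lyap f W α) x - y =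
        -((y - x) + α • gradient (lyap f W α) x) by abel, show x - y = -(y - x) by abel,
      inner_neg_neg, inner_add_left, real_inner_smul_left, real_inner_self_eq_norm_sq] at h1
    linarith
  -- General case: comparing the proximal objective at `y` and `x` gives half of that.
  · refine ⟨1, by linarith, fun x y hx hy => ?_⟩
    have hy' := ne_top_of_mem_proxSet hα hy hx₀ (h.rSum_ne_bot x₀)
    have h1 := toReal_le_of_mem_proxSet hy hy' (h.rSum_ne_bot y) hx (h.rSum_ne_bot x)
    rw [norm_sub_sq_expand x y, show x - α • gradient (lyap f W α) x - x =
        -(α • gradient (lyap f W α) x) by abel, inner_neg_left, real_inner_smul_left] at h1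
    linarith

theorem summable_of_descent {H d : ℕ → ℝ} {c m : ℝ} (hc : 0 < c) (hd : ∀ k, 0 ≤ d k)
    (hdec : ∀ k, H (k + 1) + c * d k ≤ H k) (hm : ∀ k, m ≤ H k) : Summable d := by
  refine summable_of_sum_range_le hd (c := (H 0 - m) / c) fun N => ?_
  rw [le_div_iff₀ hc, Finset.sum_mul]
  have h1 : ∑ k ∈ Finset.range N, d k * c ≤ ∑ k ∈ Finset.range N, (H k - H (k + 1)) :=
    Finset.sum_le_sum fun k _ => by linarith [hdec k]
  rw [Finset.sum_range_sub'] at h1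
  linarith [hm N]

end Convergence

end ProxDGD

/-! ### The convergence theorem -/

open ProxDGD in
theorem theorem3 {n p : ℕ} (G : SimpleGraph (Fin n)) (hG : G.Connected)
    (W : Matrix (Fin n) (Fin n) ℝ) (hW : ProxDGD.IsMixing G W)
    (f : Fin n → ProxDGD.Vec p → ℝ) (r : Fin n → ProxDGD.Vec p → EReal) (Lf : Fin n → ℝ)
    (hfr : ProxDGD.IsCompositeObjective f r Lf)
    (α : ℝ) (hα : 0 < α)
    (hstep : ((∀ i, ProxDGD.ExtConvex (r i)) ∧
        α < (1 + ProxDGD.lambdaMin hW.symm) / (⨆ i, Lf i)) ∨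
      (0 < ProxDGD.lambdaMin hW.symm ∧ α < ProxDGD.lambdaMin hW.symm / (⨆ i, Lf i)))
    (x : ℕ → ProxDGD.Mat n p) (hx : ProxDGD.IsProxDGD f r W α x)
    -- the subgradients selected by the proximal steps; `ξ 0` is unconstrained
    (ξ : ℕ → ProxDGD.Mat n p)
    (hξ : ∀ k, x (k + 1) + α • ξ (k + 1) = ProxDGD.mulMat W (x k) - α • ProxDGD.gradF f (x k)) :
    -- boundedness, existence and stationarity of accumulation points
    Bornology.IsBounded (Set.range x) ∧
    (∃ xs, MapClusterPt xs atTop x) ∧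
    (∀ xs, MapClusterPt xs atTop x → ProxDGD.IsStationary (ProxDGD.lyapHat f r W α) xs) ∧
    -- the `ξ (k + 1)` are subgradients of `r`
    (∀ k, ξ (k + 1) ∈ ProxDGD.limitingSubdiff (ProxDGD.rSum r) (x (k + 1))) ∧
    -- the subgradients of `lyapHat` that they give, with their bound
    (∀ k, gradient (ProxDGD.lyap f W α) (x (k + 1)) + ξ (k + 1) ∈
          ProxDGD.limitingSubdiff (ProxDGD.lyapHat f r W α) (x (k + 1)) ∧
        ‖gradient (ProxDGD.lyap f W α) (x (k + 1)) + ξ (k + 1)‖ ≤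
          (α⁻¹ * (2 - ProxDGD.lambdaMin hW.symm) + ⨆ i, Lf i) * ‖x (k + 1) - x k‖) ∧
    -- running best rates
    ProxDGD.RunningBestLittleO (fun k => ‖x (k + 1) - x k‖ ^ 2) ∧
    (∀ g : ℕ → ProxDGD.Mat n p,
      (∀ k, g (k + 1) ∈ ProxDGD.limitingSubdiff (ProxDGD.lyapHat f r W α) (x (k + 1)) ∧
        ‖g (k + 1)‖ ≤
          (α⁻¹ * (2 - ProxDGD.lambdaMin hW.symm) + ⨆ i, Lf i) * ‖x (k + 1) - x k‖) →
      ProxDGD.RunningBestLittleO (fun k => ‖g (k + 1)‖ ^ 2)) ∧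
    ProxDGD.RunningBestLittleO
      (fun k => ‖ProxDGD.rowAvg (ProxDGD.gradF f (x k)) + ProxDGD.rowAvg (ξ k)‖ ^ 2) ∧
    -- ergodic rate
    Asymptotics.IsBigO atTop
      (fun K : ℕ => 1 / (K : ℝ) *
        ∑ k ∈ Finset.range K, ‖ProxDGD.rowAvg (ProxDGD.gradF f (x k) + ξ k)‖ ^ 2)
      (fun K : ℕ => 1 / (K : ℝ)) ∧
    -- convergence of the whole sequence
    (∀ xs, MapClusterPt xs atTop x → ProxDGD.HasKL (ProxDGD.lyapHat f r W α) xs →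
      Tendsto x atTop (𝓝 xs)) := by
  obtain ⟨i₀⟩ := hG.nonempty
  have : NeZero n := ⟨fun h0 => by subst h0; exact i₀.elim0⟩
  have hW1 := hW.le_one
  have hW2 := hW.neg_one_lt.posSemidef
  set L := ⨆ i, Lf i 
  have hL0 : 0 ≤ L := (hfr.lip_pos i₀).le.trans (le_iSup_fin Lf i₀)
  have hL := hfr.lipschitz_iSup
  have hlam : lambdaMin hW.symm ≤ 1 := lambdaMin_le_one hW.symm hW1
  obtain ⟨c, hc, hdesc⟩ := hfr.exists_descent (p := p) hW.symm hW1 hα (hstep.imp_right And.right)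
  obtain ⟨x₀, hx₀⟩ := hfr.exists_rSum_ne_top (p := p)
  have hfin : ∀ k, rSum r (x (k + 1)) ≠ ⊤ := fun k =>
    ne_top_of_mem_proxSet hα (hx k) hx₀ (hfr.rSum_ne_bot x₀)
  -- Values are recorded from `x 1` on, since r may be +∞ at the arbitrary starting point.
  set H : ℕ → ℝ := fun k => lyap f W α (x (k + 1)) + (rSum r (x (k + 1))).toReal with hHdef
  have hval : ∀ k, lyapHat f r W α (x (k + 1)) = H k := fun k => by
    rw [lyapHat, hHdef, EReal.coe_add, EReal.coe_toReal (hfin k) (hfr.rSum_ne_bot _)]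
  have hdec : ∀ k, H (k + 1) + c * ‖x (k + 1 + 1) - x (k + 1)‖ ^ 2 ≤ H k := fun k =>
    hdesc _ _ (hfin k) (hx (k + 1))
  obtain ⟨⟨m, hm⟩, hbdd⟩ := hfr.isBounded_sublevel (p := p) hW1 hα
  have hmH : ∀ k, m ≤ H k := fun k => by
    have := hm (x (k + 1))
    rwa [hval, EReal.coe_le_coe_iff] at this
  have hanti : Antitone H := antitone_nat_of_succ_le fun k => by
    have := hdec k
    have : 0 ≤ c * ‖x (k + 1 + 1) - x (k + 1)‖ ^ 2 := by positivity
    linarith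
  have hlim : Tendsto H atTop (𝓝 (⨅ k, H k)) :=
    tendsto_atTop_ciInf hanti ⟨m, by rintro _ ⟨k, rfl⟩; exact hmH k⟩
  set Hs := ⨅ k, H k
  -- square summability of the steps
  have hsum : Summable fun k => ‖x (k + 1) - x k‖ ^ 2 :=
    (summable_nat_add_iff 1).1 (summable_of_descent hc (fun _ => sq_nonneg _) hdec hmH)
  have hd0 : Tendsto (fun k => ‖x (k + 1) - x k‖) atTop (𝓝 0) := by
    have := (Real.continuous_sqrt.tendsto 0).comp hsum.tendsto_atTop_zero
    simpa [Function.comp_def] using this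
  -- subgradients
  have hξ' : ∀ k, ξ (k + 1) = α⁻¹ • (mulMat W (x k) - α • gradF f (x k) - x (k + 1)) :=
    fun k => by rw [← hξ k, add_sub_cancel_left, inv_smul_smul₀ hα.ne']
  have hreg : ∀ k, ξ (k + 1) ∈ regularSubdiff (rSum r) (x (k + 1)) := fun k => by
    rw [hξ' k]
    exact smul_sub_mem_regularSubdiff_of_mem_proxSet hα hfr.rSum_ne_bot (hx k) (hfin k)
  have hreg' : ∀ k, gradient (lyap f W α) (x (k + 1)) + ξ (k + 1) ∈
      regularSubdiff (lyapHat f r W α) (x (k + 1)) := fun k => by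
    rw [gradient_lyap hfr.differentiable hW.symm hW1]
    exact add_mem_regularSubdiff_of_hasGradientAt
      (hasGradientAt_lyap hfr.differentiable hW.symm hW1 α _) (hreg k)
  set b := α⁻¹ * (2 - lambdaMin hW.symm) + L 
  have hb0 : 0 ≤ b := by
    have : 0 ≤ 2 - lambdaMin hW.symm := by linarith
    positivity
  have hgb : ∀ k, ‖gradient (lyap f W α) (x (k + 1)) + ξ (k + 1)‖ ≤ b * ‖x (k + 1) - x k‖ :=
    fun k => by
      refine (norm_gradient_lyap_add_le hfr.differentiable hL0 hL hW.symm hW1 hW2 hα (hξ k)).trans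
        (mul_le_mul_of_nonneg_right (add_le_add_left ?_ L) (norm_nonneg _))
      -- λ_n ≤ 1 gives 1 ≤ 2 − λ_n, so the sharper constant α⁻¹ + L implies the stated one.
      exact le_mul_of_one_le_right (by positivity) (by linarith)
  -- boundedness and accumulation points
  have hbounded : Bornology.IsBounded (Set.range x) := by
    refine ((hbdd (H 0)).insert (x 0)).subset ?_
    rintro _ ⟨k, rfl⟩
    rcases k with _ | k
    · exact Set.mem_insert _ _
    · refine Set.mem_insert_of_mem _ ?_
      rw [Set.mem_ofPred_eq, hval, EReal.coe_le_coe_iff]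
      exact hanti (Nat.zero_le k)
  have hsubseq : ∀ xs, MapClusterPt xs atTop x → ∃ ψ : ℕ → ℕ, StrictMono ψ ∧
      Tendsto (fun j => x (ψ j)) atTop (𝓝 xs) ∧ Tendsto (fun j => x (ψ j + 1)) atTop (𝓝 xs) ∧
      lyapHat f r W α xs = Hs := by
    intro xs hxs
    obtain ⟨ψ, hψ, hψlim⟩ := hxs.tendsto_subseq
    have h1 : Tendsto (fun j => x (ψ j + 1)) atTop (𝓝 xs) := by
      have h2 : Tendsto (fun j => x (ψ j + 1) - x (ψ j)) atTop (𝓝 0) :=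
        tendsto_zero_iff_norm_tendsto_zero.2 (hd0.comp hψ.tendsto_atTop)
      have h3 := h2.add hψlim
      simpa using h3
    refine ⟨ψ, hψ, hψlim, h1, ?_⟩
    refine eq_of_tendsto_proxSet (H := fun j => H (ψ j)) hα hfr.rSum_ne_bot
      (hfr.lowerSemicontinuous_lyapHat hW.symm hW1 α)
      (continuous_iff_continuousAt.2 fun y =>
        (hasGradientAt_lyap hfr.differentiable hW.symm hW1 α y).continuousAt)
      (fun j => hx (ψ j)) h1
      (((continuous_forward_step hL0 hL hW.symm hW1 hW2 α).tendsto xs).comp hψlim)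
      (fun j => hval (ψ j)) (hlim.comp hψ.tendsto_atTop)
  -- the averaged residuals
  have havg : ∀ k, ‖rowAvg (gradF f (x (k + 1)) + ξ (k + 1))‖ ^ 2 ≤
      b ^ 2 * ‖x (k + 1) - x k‖ ^ 2 := fun k => by
    have h1 : rowAvg (gradF f (x (k + 1)) + ξ (k + 1)) =
        rowAvg (gradient (lyap f W α) (x (k + 1)) + ξ (k + 1)) := by
      rw [gradient_lyap hfr.differentiable hW.symm hW1, ← smul_mulMat]
      rw [add_right_comm, rowAvg_add _ (mulMat _ _), smul_mulMat, ← mulMat_smul,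
        rowAvg_one_sub_mulMat hW, add_zero]
    rw [h1, ← mul_pow]
    exact pow_le_pow_left₀ (norm_nonneg _) ((norm_rowAvg_le _).trans (hgb k)) 2
  -- The arbitrary `ξ 0` enters a single term and does not affect summability.
  have havgsum : Summable fun k => ‖rowAvg (gradF f (x k) + ξ k)‖ ^ 2 :=
    (summable_nat_add_iff 1).1 ((hsum.mul_left (b ^ 2)).of_nonneg_of_le
      (fun _ => sq_nonneg _) havg)
  refine ⟨hbounded, ?_, ?_, fun k => regularSubdiff_subset_limitingSubdiff _ _ (hreg k),
    fun k => ⟨regularSubdiff_subset_limitingSubdiff _ _ (hreg' k), hgb k⟩,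
    runningBestLittleO_of_summable (fun _ => sq_nonneg _) hsum, ?_, ?_, ?_, ?_⟩
  · obtain ⟨a, -, φ, hφ, hφlim⟩ := tendsto_subseq_of_bounded hbounded (fun k => Set.mem_range_self k)
    exact ⟨a, hφlim.mapClusterPt.of_comp hφ.tendsto_atTop⟩
  · intro xs hxs
    obtain ⟨ψ, hψ, -, h1, h2⟩ := hsubseq xs hxs
    refine ⟨by rw [h2]; exact EReal.coe_ne_top _, by rw [h2]; exact EReal.coe_ne_bot _,
      fun j => x (ψ j + 1), fun j => gradient (lyap f W α) (x (ψ j + 1)) + ξ (ψ j + 1), h1, ?_,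
      fun j => hreg' (ψ j), ?_⟩
    · simp only [hval, h2]
      exact EReal.tendsto_coe.2 (hlim.comp hψ.tendsto_atTop)
    · refine squeeze_zero_norm (fun j => hgb (ψ j)) ?_
      simpa using (hd0.comp hψ.tendsto_atTop).const_mul b
  · intro g hg
    refine runningBestLittleO_of_summable (fun _ => sq_nonneg _)
      ((hsum.mul_left (b ^ 2)).of_nonneg_of_le (fun _ => sq_nonneg _) fun k => ?_)
    rw [← mul_pow]
    exact pow_le_pow_left₀ (norm_nonneg _) (hg k).2 2
  · simp only [← rowAvg_add]
    exact runningBestLittleO_of_summable (fun _ => sq_nonneg _) havgsum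
  · refine Asymptotics.IsBigO.of_bound (∑' k, ‖rowAvg (gradF f (x k) + ξ k)‖ ^ 2)
      (Eventually.of_forall fun K => ?_)
    rw [norm_mul, mul_comm]
    refine mul_le_mul_of_nonneg_right ?_ (norm_nonneg _)
    rw [Real.norm_of_nonneg (Finset.sum_nonneg fun _ _ => sq_nonneg _)]
    exact havgsum.sum_le_tsum _ fun _ _ => sq_nonneg _
  · intro xs hxs hKL
    obtain ⟨ψ, hψ, hψlim, -, h2⟩ := hsubseq xs hxs
    -- The KŁ argument runs on the shifted sequence, whose values are all finite.
    have hcl : MapClusterPt xs atTop fun k => x (k + 1) := by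
      rw [MapClusterPt, ← Function.comp_def x, ← Filter.map_map, Filter.map_add_atTop_eq_nat]
      exact hxs
    exact (tendsto_add_atTop_iff_nat 1).1 (tendsto_of_hasKL hval hc hb0 hdec
      (fun k => ⟨_, regularSubdiff_subset_limitingSubdiff _ _ (hreg' (k + 1)), hgb (k + 1)⟩)
      hcl h2 hlim hKL)
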